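/- Consider $N\ge 3$ particles on the real line with real masses $m_1,\dots,m_N$ (of any sign) and positions $x_1\le\dots\le x_N$. Put $M=m_1+\dots+m_N$, $B(y,z)=\sum_{i=1}^N y_i m_i z_i$ on $\mathbb R^N$, and $P_0=\{x\in\mathbb R^N:\sum_i m_ix_i=0\}$. A solution is a motion $x(t)$, on an open time interval containing the initial time $0$, such that the order $x_1\le\dots\le x_N$ is kept, the particles move with constant velocities between collisions, three particles are never at the same place, and whenever two particles $i,j$ are in contact their velocities $v_i,v_j$ before and $w_i,w_j$ after are related by the law of elastic collisions $w_i=(1-\mu_{ij})v_i+\mu_{ij}v_j$, $w_j=\mu_{ji}v_i+(1-\mu_{ji})v_j$, where $\mu_{ij}=2m_j/(m_i+m_j)$. It is maximal if it cannot be extended to a solution on a larger open interval. Two particles collide at time $t$ if they meet at time $t$ and are apart immediately before and after. A solution has a collapse at $s\in\mathbb R$ if there is a strictly monotone sequence of collision times converging to $s$. The collapse is global if each pair of adjacent particles has infinitely many collisions as $t\to s$. A solution has a double global collapse if it has a global collapse at some $s_1>0$ and at some $s_2<0$. It has a direct multiple collision at $s$ (possibly an end of its time interval) if there are three or more consecutive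 particles whose diameter tends to $0$ as $t\to s$ and which have no collisions among them at the times of the interval near $s$. It is trivial if all the velocities are equal. Let $E$ be the kinetic energy in the inertial frame of the center of mass, $E=\frac12\sum_i m_i(v_i-V)^2$ with $V=\frac1M\sum_i m_iv_i$ and $v$ the initial velocity; thus $E=\frac12\sum_i m_iv_i^2$ if the center of mass is fixed at the origin. Assume that $$m_2,\dots,m_{N-1}<0,\qquad m_1+\dots+m_{N-1}>0,\qquad (m_2+\dots+m_N)M>0 .$$ Then: 1. every collapse of every solution is global; 2. the restriction $B|_{P_0}$ is non-degenerate of signature $(1,N-2)$; 3. every non-trivial maximal solution without direct multiple collisions has a double global collapse if $E<0$, and has a global collapse if $E\ge 0$. -/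

import Mathlib

open Filter Topology

namespace LineParticles

variable {N : ℕ}

/-! ### Masses, momentum and kinetic energy -/

/-- The total mass `M`. -/
noncomputable def totalMass (m : Fin N → ℝ) : ℝ := ∑ i, m i

/-- The momentum `∑ i, m i * v i`. -/
noncomputable def momentum (m v : Fin N → ℝ) : ℝ := ∑ i, m i * v i

/-- The symmetric bilinear form `B(y, z) = ∑ i, y i * m i * z i`. -/
noncomputable def massForm (m : Fin N → ℝ) : LinearMap.BilinForm ℝ (Fin N → ℝ) :=
  LinearMap.mk₂ ℝ (fun y z => ∑ i, y i * m i * z i)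
    (fun y y' z => by simp only [Pi.add_apply, add_mul, Finset.sum_add_distrib])
    (fun c y z => by simp only [Pi.smul_apply, smul_eq_mul, Finset.mul_sum, mul_assoc])
    (fun y z z' => by simp only [Pi.add_apply, mul_add, Finset.sum_add_distrib])
    (fun c y z => by
      simp only [Pi.smul_apply, smul_eq_mul, Finset.mul_sum]
      exact Finset.sum_congr rfl fun i _ => by ring)

/-- The kinetic energy `E = Q(v) / 2` with `Q(v) = B(v, v)`. -/
noncomputable def kineticEnergy (m v : Fin N → ℝ) : ℝ := massForm m v v / 2

/-- The kinetic energy measured in the inertial frame of the center of mass, which moves with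
velocity `P / M`. It is `kineticEnergy m v` when the center of mass is at rest. -/
noncomputable def energy (m v : Fin N → ℝ) : ℝ :=
  kineticEnergy m fun i => v i - momentum m v / totalMass m

/-- The subspace `P₀` of the vectors `x` with `∑ i, m i * x i = 0`. -/
noncomputable def zeroMomentum (m : Fin N → ℝ) : Submodule ℝ (Fin N → ℝ) where
  carrier := {x | ∑ i, m i * x i = 0}
  add_mem' {x y} hx hy := by
    simp only [Set.mem_ofPred_eq, Pi.add_apply, mul_add, Finset.sum_add_distrib] at *
    rw [hx, hy, add_zero]
  zero_mem' := by simp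
  smul_mem' c x hx := by
    simp only [Set.mem_ofPred_eq, Pi.smul_apply, smul_eq_mul] at *
    rw [← mul_zero c, ← hx, Finset.mul_sum]
    exact Finset.sum_congr rfl fun i _ => by ring

/-- A symmetric bilinear form has signature `(p, q)`: it is non-degenerate and its quadratic form
has positive and negative indices of inertia `p` and `q`. -/
def HasSignature {V : Type*} [AddCommGroup V] [Module ℝ V] (B : LinearMap.BilinForm ℝ V)
    (p q : ℕ) : Prop :=
  B.Nondegenerate ∧ sigPos B.toQuadraticMap = p ∧
    sigNeg B.toQuadraticMap = q

/-- The conditions on the masses: with one-based indices, `m₂, …, m_{N-1} < 0`,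
`m₁ + ⋯ + m_{N-1} > 0` and `(m₂ + ⋯ + m_N) * M > 0`. -/
structure MassCondition (m : Fin N → ℝ) : Prop where
  inner_neg : ∀ i : Fin N, 0 < i.val → i.val + 1 < N → m i < 0
  left_pos : 0 < ∑ i : Fin N with i.val + 1 < N, m i
  right_pos : 0 < (∑ i : Fin N with 0 < i.val, m i) * totalMass m

/-! ### Dynamics -/

/-- The coefficient `μ_{ij} = 2 m_j / (m_i + m_j)`. -/
noncomputable def collisionCoeff (m : Fin N → ℝ) (i j : Fin N) : ℝ := 2 * m j / (m i + m j)

/-- At the configuration `q` the velocities `v` are changed into the velocities `w`: there is no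
contact of three particles, each pair of particles in contact follows the law of elastic
collisions, and the other particles keep their velocities. -/
structure CollisionLaw (m q v w : Fin N → ℝ) : Prop where
  no_triple : ∀ i j k, i ≠ j → j ≠ k → i ≠ k → ¬(q i = q j ∧ q j = q k)
  contact : ∀ i j, i ≠ j → q i = q j →
    w i = (1 - collisionCoeff m i j) * v i + collisionCoeff m i j * v j
  free : ∀ i, (∀ j, j ≠ i → q j ≠ q i) → w i = v i

/-- `v` is the velocity of `x` immediately before the time `t`. -/
def VelocityBefore (x : ℝ → Fin N → ℝ) (t : ℝ) (v : Fin N → ℝ) : Prop :=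
  ∀ᶠ s in 𝓝[<] t, x s = x t + (s - t) • v

/-- `w` is the velocity of `x` immediately after the time `t`. -/
def VelocityAfter (x : ℝ → Fin N → ℝ) (t : ℝ) (w : Fin N → ℝ) : Prop :=
  ∀ᶠ s in 𝓝[>] t, x s = x t + (s - t) • w

/-- The open time interval `(a, b)`, where `a` and `b` may be infinite. -/
def timeInterval (a b : EReal) : Set ℝ := {t : ℝ | a < (t : EReal) ∧ (t : EReal) < b}

/-- `x` is a motion, on the open time interval `(a, b)` around the initial time `0`, of particles
with masses `m` ordered on the line: before and after each time the velocities are constant for a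
while, and they obey the law of collisions. -/
structure IsSolution (m : Fin N → ℝ) (a b : EReal) (x : ℝ → Fin N → ℝ) : Prop where
  start_neg : a < 0
  end_pos : 0 < b
  ordered : ∀ t ∈ timeInterval a b, Monotone (x t)
  law : ∀ t ∈ timeInterval a b, ∃ v w, VelocityBefore x t v ∧ VelocityAfter x t w ∧
    CollisionLaw m (x t) v w

/-- A solution that cannot be extended to a larger open time interval. -/
structure IsMaximalSolution (m : Fin N → ℝ) (a b : EReal) (x : ℝ → Fin N → ℝ) : Prop where
  isSolution : IsSolution m a b x
  maximal : ∀ (a' b' : EReal) (x' : ℝ → Fin N → ℝ), a' ≤ a → b ≤ b' → IsSolution m a' b' x' →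
    Set.EqOn x' x (timeInterval a b) → a' = a ∧ b' = b

/-! ### Collisions and collapses -/

/-- The particles `i` and `j` collide at the time `t`: they meet, and they are apart immediately
before and after. (Two particles that move together, with equal velocities, are not colliding.) -/
def Collide (x : ℝ → Fin N → ℝ) (i j : Fin N) (t : ℝ) : Prop :=
  x t i = x t j ∧ ∀ᶠ s in 𝓝[≠] t, x s i ≠ x s j

/-- The solution has a collapse at the time `s`: there is a strictly monotone sequence of
collision times that converges to `s`. -/
def HasCollapse (a b : EReal) (x : ℝ → Fin N → ℝ) (s : ℝ) : Prop :=
  ∃ t : ℕ → ℝ, (StrictMono t ∨ StrictAnti t) ∧ Tendsto t atTop (𝓝 s) ∧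
    ∀ n, t n ∈ timeInterval a b ∧ ∃ i j, i ≠ j ∧ Collide x i j (t n)

/-- The solution has a global collapse at the time `s`: it has a collapse and each pair of
adjacent particles collides infinitely many times as `t → s`. -/
def HasGlobalCollapse (a b : EReal) (x : ℝ → Fin N → ℝ) (s : ℝ) : Prop :=
  HasCollapse a b x s ∧ ∀ i j : Fin N, i.val + 1 = j.val →
    ∃ᶠ t in 𝓝[≠] s, t ∈ timeInterval a b ∧ Collide x i j t

/-- The solution has a global collapse in the future and another one in the past. -/
def HasDoubleGlobalCollapse (a b : EReal) (x : ℝ → Fin N → ℝ) : Prop :=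
  ∃ s₁ s₂ : ℝ, 0 < s₁ ∧ s₂ < 0 ∧ HasGlobalCollapse a b x s₁ ∧ HasGlobalCollapse a b x s₂

/-- Three or more consecutive particles `i, i + 1, …, k` have a direct multiple collision at the
time `s`: their diameter `x k - x i` tends to `0` as `t → s` within the interval of definition,
and there are no collisions between them at the times near `s`. The time `s` may be either end of
the interval. -/
def HasDirectMultipleCollision (a b : EReal) (x : ℝ → Fin N → ℝ) (s : ℝ) : Prop :=
  s ∈ closure (timeInterval a b) ∧ ∃ i k : Fin N, i.val + 2 ≤ k.val ∧
    Tendsto (fun t => x t k - x t i) (𝓝[timeInterval a b \ {s}] s) (𝓝 0) ∧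
    ∀ᶠ t in 𝓝[timeInterval a b \ {s}] s, ∀ j l : Fin N, i ≤ j → j < l → l ≤ k →
      ¬Collide x j l t

end LineParticles

namespace LineParticles
variable {N : ℕ}

/-! The form `relForm m S` measures a group `S` relative to its center of mass; if the group has
nonzero mass, the form ignores translations. Elastic collisions inside the group preserve momentum,
energy and the moment `∑ m q v`. Hence, as long as the group is isolated, `relForm` of its
configuration is the same quadratic polynomial in time as for the free motion extrapolated from any
instant (`relForm_eq_extrapolation`). The sign of the form does the rest.

A group that misses the first or the last particle has a form that is negative definite modulo
translations (`MassCondition.negDefOn`). Its conserved energy bounds the relative velocities, so the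
distances have limits at every finite time. If they all tend to zero at `e`, the extrapolated free
motion focuses at `e` too; two particles that collide at another time would then coincide twice
along a free motion, hence have equal velocities, which is absurd. Otherwise the group splits into
smaller isolated groups, and induction excludes accumulation of collisions
(`eventually_not_collide`). If some adjacent pair stopped colliding, the system would split into two
such groups, so every collapse is global.

The form of the whole system is positive on ordered configurations that are not a single point
(`relForm_pos`). On a suitable hyperplane it is nonpositive and vanishes only on translations
(`exists_hyperplane`). Counting dimensions gives the signature. Moreover the straight line
extrapolated from the initial data must stay in the positive region during the life of the solution.
If `E < 0` it leaves that region in both time directions; if `E ≥ 0` and the solution is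
non-trivial, it meets the hyperplane at some time. So both ends of the time interval, respectively
at least one, are finite. At a finite end collisions accumulate: otherwise the motion is uniform up
to that end, and its limit either has a triple contact, giving a direct multiple collision, or
allows an extension (`exists_extension_right`). -/

/-! ### The mass form relative to the center of mass of a group of particles -/

/-- The mass form of the particles of `S`, with their velocities taken relative to their center of
mass. -/
noncomputable def relForm (m : Fin N → ℝ) (S : Finset (Fin N)) (y z : Fin N → ℝ) : ℝ :=
  ∑ l ∈ S, m l * y l * z l - (∑ l ∈ S, m l * y l) * (∑ l ∈ S, m l * z l) / ∑ l ∈ S, m l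

theorem relForm_add_smul (m : Fin N → ℝ) (S : Finset (Fin N)) (y w : Fin N → ℝ) (t : ℝ) :
    relForm m S (y + t • w) (y + t • w) =
      relForm m S y y + 2 * t * relForm m S y w + t ^ 2 * relForm m S w w := by
  have h1 : ∑ l ∈ S, m l * (y l + t * w l) * (y l + t * w l) =
      ∑ l ∈ S, m l * y l * y l + 2 * t * ∑ l ∈ S, m l * y l * w l
        + t ^ 2 * ∑ l ∈ S, m l * w l * w l := by
    simp only [Finset.mul_sum, ← Finset.sum_add_distrib]
    exact Finset.sum_congr rfl fun l _ => by ring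
  have h2 : ∑ l ∈ S, m l * (y l + t * w l) = ∑ l ∈ S, m l * y l + t * ∑ l ∈ S, m l * w l := by
    simp only [Finset.mul_sum, ← Finset.sum_add_distrib]
    exact Finset.sum_congr rfl fun l _ => by ring
  simp only [relForm, Pi.add_apply, Pi.smul_apply, smul_eq_mul, h1, h2]
  ring

theorem relForm_sub_const (m : Fin N → ℝ) (S : Finset (Fin N)) (hS : ∑ l ∈ S, m l ≠ 0)
    (x : Fin N → ℝ) (c : ℝ) :
    relForm m S (fun l => x l - c) (fun l => x l - c) = relForm m S x x := by
  have h1 : ∑ l ∈ S, m l * (x l - c) * (x l - c) =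
      ∑ l ∈ S, m l * x l * x l - 2 * c * ∑ l ∈ S, m l * x l + c ^ 2 * ∑ l ∈ S, m l := by
    simp only [Finset.mul_sum, ← Finset.sum_add_distrib, ← Finset.sum_sub_distrib]
    exact Finset.sum_congr rfl fun l _ => by ring
  have h2 : ∑ l ∈ S, m l * (x l - c) = ∑ l ∈ S, m l * x l - c * ∑ l ∈ S, m l := by
    simp only [Finset.mul_sum, ← Finset.sum_sub_distrib]
    exact Finset.sum_congr rfl fun l _ => by ring
  simp only [relForm, h1, h2]
  field_simp
  ring

/-- Conservation of the relative mass form along a change of velocities follows from conservation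
of momentum, energy and moment. -/
theorem relForm_congr {m : Fin N → ℝ} {S : Finset (Fin N)} {q v w : Fin N → ℝ}
    (h1 : ∑ l ∈ S, m l * w l = ∑ l ∈ S, m l * v l)
    (h2 : ∑ l ∈ S, m l * w l * w l = ∑ l ∈ S, m l * v l * v l)
    (h3 : ∑ l ∈ S, m l * q l * w l = ∑ l ∈ S, m l * q l * v l) :
    relForm m S w w = relForm m S v v ∧ relForm m S q w = relForm m S q v := by
  simp only [relForm, h1, h2, h3, and_self]

theorem relForm_sub_smul (m : Fin N → ℝ) (S : Finset (Fin N)) (q w : Fin N → ℝ) (t : ℝ) :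
    relForm m S (q - t • w) w = relForm m S q w - t * relForm m S w w := by
  have h1 : ∑ l ∈ S, m l * (q l - t * w l) * w l =
      ∑ l ∈ S, m l * q l * w l - t * ∑ l ∈ S, m l * w l * w l := by
    simp only [Finset.mul_sum, ← Finset.sum_sub_distrib]
    exact Finset.sum_congr rfl fun l _ => by ring
  have h2 : ∑ l ∈ S, m l * (q l - t * w l) = ∑ l ∈ S, m l * q l - t * ∑ l ∈ S, m l * w l := by
    simp only [Finset.mul_sum, ← Finset.sum_sub_distrib]
    exact Finset.sum_congr rfl fun l _ => by ring
  simp only [relForm, Pi.sub_apply, Pi.smul_apply, smul_eq_mul, h1, h2]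
  ring

/-! ### The law of collisions -/

/-- At the configuration `q` with velocities `v`, no particle of `S` exchanges momentum with a
particle outside of `S`. -/
def Isolated (q v : Fin N → ℝ) (S : Finset (Fin N)) : Prop :=
  ∀ l ∈ S, ∀ j, j ∉ S → q j = q l → v j = v l

namespace CollisionLaw

variable {m q v w : Fin N → ℝ}

theorem eq_of_forall (h : CollisionLaw m q v w) {i : Fin N}
    (hi : ∀ j, j ≠ i → q j = q i → v j = v i) : w i = v i := by
  by_cases hf : ∀ j, j ≠ i → q j ≠ q i
  · exact h.free i hf
  · push Not at hf
    obtain ⟨j, hj, hq⟩ := hf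
    rw [h.contact i j hj.symm hq.symm, hi j hj hq]
    ring

theorem sub_eq_neg (h : CollisionLaw m q v w) {i j : Fin N} (hij : i ≠ j) (hq : q i = q j)
    (hm : m i + m j ≠ 0) : w j - w i = -(v j - v i) := by
  have hm' : m j + m i ≠ 0 := by rwa [add_comm]
  rw [h.contact i j hij hq, h.contact j i hij.symm hq.symm, collisionCoeff, collisionCoeff,
    add_comm (m j) (m i)]
  field_simp
  ring

/-- Particles that exchange momentum come in pairs. Absence of triple contacts makes the passage to
the partner (in contact, with a different velocity) an involution, and isolation keeps the partner
in `S`; the terms cancel in pairs. -/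
theorem sum_eq_zero (h : CollisionLaw m q v w) {S : Finset (Fin N)} (hS : Isolated q v S)
    {f : Fin N → ℝ} (hf : ∀ i j, i ≠ j → q i = q j → f i + f j = 0)
    (hf' : ∀ i, w i = v i → f i = 0) : ∑ l ∈ S, f l = 0 := by
  classical
  let g : Fin N → Fin N := fun a => if h : ∃ j, j ≠ a ∧ q j = q a ∧ v j ≠ v a then h.choose else a
  have g1 : ∀ a, (∃ j, j ≠ a ∧ q j = q a ∧ v j ≠ v a) →
      g a ≠ a ∧ q (g a) = q a ∧ v (g a) ≠ v a := fun a ha => by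
    simp only [g, dif_pos ha]; exact ha.choose_spec
  have g2 : ∀ a, (¬∃ j, j ≠ a ∧ q j = q a ∧ v j ≠ v a) → f a = 0 ∧ g a = a := fun a ha => by
    refine ⟨hf' a (h.eq_of_forall fun j hj hq => ?_), by simp only [g, dif_neg ha]⟩
    by_contra hv
    exact ha ⟨j, hj, hq, hv⟩
  refine Finset.sum_involution (fun a _ => g a) (fun a _ => ?_) (fun a _ ha => ?_) (fun a ha => ?_)
    fun a _ => ?_
  · by_cases hc : ∃ j, j ≠ a ∧ q j = q a ∧ v j ≠ v a
    · exact hf _ _ (g1 a hc).1.symm (g1 a hc).2.1.symm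
    · rw [(g2 a hc).2, (g2 a hc).1, add_zero]
  · by_cases hc : ∃ j, j ≠ a ∧ q j = q a ∧ v j ≠ v a
    · exact (g1 a hc).1
    · exact absurd (g2 a hc).1 ha
  · by_cases hc : ∃ j, j ≠ a ∧ q j = q a ∧ v j ≠ v a
    · by_contra hn
      exact (g1 a hc).2.2 (hS a ha _ hn (g1 a hc).2.1)
    · simpa only [(g2 a hc).2] using ha
  · by_cases hc : ∃ j, j ≠ a ∧ q j = q a ∧ v j ≠ v a
    · obtain ⟨h1, h2, h3⟩ := g1 a hc
      have hc' : ∃ j, j ≠ g a ∧ q j = q (g a) ∧ v j ≠ v (g a) := ⟨a, h1.symm, h2.symm, h3.symm⟩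
      obtain ⟨k1, k2, -⟩ := g1 _ hc'
      by_contra hn
      exact h.no_triple _ _ _ k1 h1 hn ⟨k2, h2⟩
    · simp only [(g2 a hc).2]

theorem sum_momentum (h : CollisionLaw m q v w) {S : Finset (Fin N)} (hS : Isolated q v S) :
    ∑ l ∈ S, m l * w l = ∑ l ∈ S, m l * v l := by
  rw [← sub_eq_zero, ← Finset.sum_sub_distrib]
  refine h.sum_eq_zero hS (fun i j hij hq => ?_) fun i hi => by rw [hi, sub_self]
  rw [h.contact i j hij hq, h.contact j i hij.symm hq.symm, collisionCoeff, collisionCoeff,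
    add_comm (m j) (m i)]
  ring

theorem sum_energy (h : CollisionLaw m q v w) {S : Finset (Fin N)} (hS : Isolated q v S) :
    ∑ l ∈ S, m l * w l * w l = ∑ l ∈ S, m l * v l * v l := by
  rw [← sub_eq_zero, ← Finset.sum_sub_distrib]
  refine h.sum_eq_zero hS (fun i j hij hq => ?_) fun i hi => by rw [hi, sub_self]
  rw [h.contact i j hij hq, h.contact j i hij.symm hq.symm, collisionCoeff, collisionCoeff,
    add_comm (m j) (m i)]
  -- For opposite masses the coefficients are `0` by the convention on division, so the velocities
  -- do not change.
  by_cases hm : m i + m j = 0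
  · simp [hm]
  · field_simp
    ring

/-- The two partners have the same `q`, so this is conservation of momentum weighted by position. -/
theorem sum_moment (h : CollisionLaw m q v w) {S : Finset (Fin N)} (hS : Isolated q v S) :
    ∑ l ∈ S, m l * q l * w l = ∑ l ∈ S, m l * q l * v l := by
  rw [← sub_eq_zero, ← Finset.sum_sub_distrib]
  refine h.sum_eq_zero hS (fun i j hij hq => ?_) fun i hi => by rw [hi, sub_self]
  rw [h.contact i j hij hq, h.contact j i hij.symm hq.symm, collisionCoeff, collisionCoeff,
    add_comm (m j) (m i), hq]
  ring

/-- These three numbers are, up to the factor `2`, the coefficients of `relForm` of the extrapolated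
configuration as a polynomial in time, with `q - t • v` as its position at time zero. -/
theorem relForm_eq (h : CollisionLaw m q v w) {S : Finset (Fin N)} (hS : Isolated q v S) (t : ℝ) :
    relForm m S w w = relForm m S v v ∧
    relForm m S (q - t • w) w = relForm m S (q - t • v) v ∧
    relForm m S (q - t • w) (q - t • w) = relForm m S (q - t • v) (q - t • v) := by
  obtain ⟨h1, h2⟩ := relForm_congr (h.sum_momentum hS) (h.sum_energy hS) (h.sum_moment hS)
  refine ⟨h1, by rw [relForm_sub_smul, relForm_sub_smul, h1, h2], ?_⟩
  rw [sub_eq_add_neg, sub_eq_add_neg, ← neg_smul, ← neg_smul, relForm_add_smul, relForm_add_smul,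
    h1, h2]

/-- The law of collisions is invariant under time reversal. -/
theorem reverse (h : CollisionLaw m q v w) : CollisionLaw m q (-w) (-v) := by
  refine ⟨h.no_triple, fun i j hij hq => ?_, fun i hi => by simp [h.free i hi]⟩
  simp only [Pi.neg_apply]
  rw [h.contact i j hij hq, h.contact j i hij.symm hq.symm, collisionCoeff, collisionCoeff,
    add_comm (m j) (m i)]
  by_cases hm : m i + m j = 0
  · simp [hm]
  · field_simp
    ring

end CollisionLaw

/-! ### Sign of the relative mass form -/

theorem exists_pos_forall_le (S : Finset (Fin N)) (f : Fin N → ℝ) (hf : ∀ l ∈ S, 0 < f l) :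
    ∃ κ > 0, ∀ l ∈ S, κ ≤ f l := by
  rcases S.eq_empty_or_nonempty with rfl | hne
  · exact ⟨1, one_pos, by simp⟩
  · obtain ⟨l, hl, hmin⟩ := S.exists_min_image f hne
    exact ⟨f l, hf l hl, hmin⟩

theorem add_le_neg_sum {m y : Fin N → ℝ} {S : Finset (Fin N)}
    (h : ∀ l ∈ S, m l * y l * y l ≤ 0) {k l : Fin N} (hk : k ∈ S) (hl : l ∈ S) (hkl : k ≠ l) :
    -(m k * y k * y k) + -(m l * y l * y l) ≤ -∑ i ∈ S, m i * y i * y i := by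
  rw [← Finset.sum_neg_distrib, ← Finset.sum_pair (f := fun i => -(m i * y i * y i)) hkl]
  refine Finset.sum_le_sum_of_subset_of_nonneg ?_ fun i hi _ => neg_nonneg.2 (h i hi)
  intro i hi
  simp only [Finset.mem_insert, Finset.mem_singleton] at hi
  rcases hi with rfl | rfl <;> assumption

/-- The group `S` has non-zero mass and its relative mass form is negative definite on the
differences of the particles. -/
def NegDefOn (m : Fin N → ℝ) (S : Finset (Fin N)) : Prop :=
  (S.Nonempty → ∑ l ∈ S, m l ≠ 0) ∧
    ∃ κ > 0, ∀ x : Fin N → ℝ, ∀ k ∈ S, ∀ l ∈ S, κ * (x k - x l) ^ 2 ≤ -relForm m S x x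

/-- Criterion for `NegDefOn` in terms of a choice of origin for each configuration. -/
theorem negDefOn_of_origin {m : Fin N → ℝ} {S : Finset (Fin N)} (hM : ∑ l ∈ S, m l ≠ 0)
    {κ : ℝ} (hκ : 0 < κ) (h : ∀ x : Fin N → ℝ, ∃ c : ℝ,
      (∀ l ∈ S, κ * (x l - c) ^ 2 ≤ -(m l * (x l - c) * (x l - c))) ∧
      0 ≤ (∑ l ∈ S, m l * (x l - c)) * (∑ l ∈ S, m l * (x l - c)) / ∑ l ∈ S, m l) :
    NegDefOn m S := by
  refine ⟨fun _ => hM, κ / 2, half_pos hκ, fun x k hk l hl => ?_⟩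
  obtain ⟨c, h1, h2⟩ := h x
  have hneg : ∀ i ∈ S, m i * (x i - c) * (x i - c) ≤ 0 := fun i hi => by
    have := h1 i hi
    have := mul_nonneg hκ.le (sq_nonneg (x i - c))
    linarith
  rw [← relForm_sub_const m S hM x c, relForm]
  by_cases hkl : k = l
  · subst hkl
    have := Finset.sum_nonpos hneg
    simp only [sub_self]
    linarith
  · have h3 := add_le_neg_sum (y := fun i => x i - c) hneg hk hl hkl
    have h4 := h1 k hk
    have h5 := h1 l hl
    -- The constant is halved because `(a - b) ^ 2 ≤ 2 * (a ^ 2 + b ^ 2)`.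
    have h6 : κ / 2 * (x k - x l) ^ 2 ≤ κ * (x k - c) ^ 2 + κ * (x l - c) ^ 2 := by
      nlinarith [mul_nonneg hκ.le (sq_nonneg ((x k - c) + (x l - c)))]
    linarith

/-- With the center of mass as origin, the correction term vanishes and only negative multiples of
squares remain. -/
theorem negDefOn_of_neg {m : Fin N → ℝ} {S : Finset (Fin N)} (hneg : ∀ l ∈ S, m l < 0) :
    NegDefOn m S := by
  rcases S.eq_empty_or_nonempty with rfl | hne
  · exact ⟨fun h => absurd rfl h.ne_empty, 1, one_pos, by simp⟩
  have hM : ∑ l ∈ S, m l < 0 := Finset.sum_neg hneg hne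
  obtain ⟨κ, hκ, hle⟩ := exists_pos_forall_le S (fun l => -m l) fun l hl => neg_pos.2 (hneg l hl)
  refine negDefOn_of_origin hM.ne hκ fun x => ⟨(∑ l ∈ S, m l * x l) / ∑ l ∈ S, m l, ?_, ?_⟩
  · intro l hl
    nlinarith [mul_le_mul_of_nonneg_right (hle l hl)
      (sq_nonneg (x l - (∑ l ∈ S, m l * x l) / ∑ l ∈ S, m l))]
  · have : ∑ l ∈ S, m l * (x l - (∑ l ∈ S, m l * x l) / ∑ l ∈ S, m l) = 0 := by
      simp only [mul_sub, Finset.sum_sub_distrib, ← Finset.sum_mul]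
      field_simp [hM.ne]
      ring
    simp [this]

/-- An origin at `p` removes the only mass of uncontrolled sign from the sum of squares, and the
positive total mass gives the correction term the favorable sign. -/
theorem negDefOn_of_pos {m : Fin N → ℝ} {S : Finset (Fin N)} {p : Fin N}
    (hneg : ∀ l ∈ S, l ≠ p → m l < 0) (hM : 0 < ∑ l ∈ S, m l) : NegDefOn m S := by
  obtain ⟨κ, hκ, hle⟩ := exists_pos_forall_le (S.erase p) (fun l => -m l) fun l hl =>
    neg_pos.2 (hneg l (Finset.mem_of_mem_erase hl) (Finset.ne_of_mem_erase hl))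
  refine negDefOn_of_origin hM.ne' hκ fun x => ⟨x p, fun l hl => ?_, ?_⟩
  · by_cases hlp : l = p
    · simp [hlp]
    · nlinarith [mul_le_mul_of_nonneg_right (hle l (Finset.mem_erase.2 ⟨hlp, hl⟩))
        (sq_nonneg (x l - x p))]
  · exact div_nonneg (mul_self_nonneg _) hM.le

namespace MassCondition

variable {m : Fin N → ℝ}

theorem totalMass_eq_left {z : Fin N} (hz : z.val + 1 = N) :
    totalMass m = ∑ i : Fin N with i.val + 1 < N, m i + m z := by
  rw [totalMass, ← Finset.sum_filter_add_sum_filter_not _ (fun i : Fin N => i.val + 1 < N)]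
  congr 1
  rw [Finset.sum_eq_single_of_mem z (by simp [hz])]
  intro b hb hbz
  simp only [Finset.mem_filter] at hb
  exact absurd (Fin.ext (by omega)) hbz

theorem totalMass_ne_zero (hm : MassCondition m) : totalMass m ≠ 0 :=
  fun h => by have := hm.right_pos; simp [h] at this

theorem right_mass_pos (hm : MassCondition m) (h : 0 < totalMass m) :
    0 < ∑ i : Fin N with 0 < i.val, m i :=
  pos_of_mul_pos_left hm.right_pos h.le

/-- Only the last mass needs an argument: it is `M` minus the positive mass of all the other
particles. -/
theorem neg_of_totalMass_neg (hm : MassCondition m) (h : totalMass m < 0) {i : Fin N}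
    (hi : 0 < i.val) : m i < 0 := by
  by_cases hz : i.val + 1 = N
  · have := totalMass_eq_left (m := m) hz
    have := hm.left_pos
    linarith
  · exact hm.inner_neg i hi (by omega)

/-- Proper groups of particles have a negative definite relative mass form. -/
theorem negDefOn (hm : MassCondition m) {S : Finset (Fin N)}
    (hS : (∀ l ∈ S, 0 < l.val) ∨ ∀ l ∈ S, l.val + 1 < N) : NegDefOn m S := by
  -- Dropping particles of nonpositive mass does not lower the mass, so the positive mass of a
  -- maximal proper group passes to its subgroups that keep the end particle.
  have key : ∀ T : Finset (Fin N), S ⊆ T → (∀ l ∈ T, l ∉ S → m l ≤ 0) →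
      ∑ l ∈ T, m l ≤ ∑ l ∈ S, m l := fun T hT hT' => by
    rw [← Finset.sum_sdiff hT]
    have := Finset.sum_nonpos (s := T \ S) (f := m) fun l hl => by
      rw [Finset.mem_sdiff] at hl
      exact hT' l hl.1 hl.2
    linarith
  rcases hS with hS | hS
  · rcases lt_or_gt_of_ne hm.totalMass_ne_zero with hM | hM
    · exact negDefOn_of_neg fun l hl => hm.neg_of_totalMass_neg hM (hS l hl)
    · by_cases hz : ∃ z ∈ S, z.val + 1 = N
      · obtain ⟨z, hzS, hz⟩ := hz
        refine negDefOn_of_pos (p := z) (fun l hl hlz => ?_) ?_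
        · exact hm.inner_neg l (hS l hl) (by have : l.val ≠ z.val := fun h => hlz (Fin.ext h); omega)
        · refine (hm.right_mass_pos hM).trans_le (key _ (fun l hl => by simp [hS l hl]) ?_)
          intro l hl hlS
          simp only [Finset.mem_filter] at hl
          refine (hm.inner_neg l hl.2 ?_).le
          have : l.val ≠ z.val := fun h => hlS (by rwa [Fin.ext h])
          omega
      · push Not at hz
        exact negDefOn_of_neg fun l hl => hm.inner_neg l (hS l hl) (by have := hz l hl; omega)
  · by_cases hz : ∃ z ∈ S, z.val = 0
    · obtain ⟨z, hzS, hz⟩ := hz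
      refine negDefOn_of_pos (p := z) (fun l hl hlz => ?_) ?_
      · exact hm.inner_neg l (by have : l.val ≠ z.val := fun h => hlz (Fin.ext h); omega) (hS l hl)
      · refine hm.left_pos.trans_le (key _ (fun l hl => by simp [hS l hl]) ?_)
        intro l hl hlS
        simp only [Finset.mem_filter] at hl
        refine (hm.inner_neg l ?_ hl.2).le
        have : l.val ≠ z.val := fun h => hlS (by rwa [Fin.ext h])
        omega
    · push Not at hz
      exact negDefOn_of_neg fun l hl => hm.inner_neg l (by have := hz l hl; omega) (hS l hl)

theorem add_ne_zero (hm : MassCondition m) {i j : Fin N} (hij : i ≠ j)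
    (h : (0 < i.val ∧ 0 < j.val) ∨ (i.val + 1 < N ∧ j.val + 1 < N)) : m i + m j ≠ 0 := by
  intro h0
  obtain ⟨hM, -⟩ := hm.negDefOn (S := {i, j}) (by simpa using h)
  exact hM ⟨i, by simp⟩ (by rw [Finset.sum_pair hij, h0])

/-- Ordered configurations that are not concentrated at one point are timelike. -/
theorem relForm_pos (hm : MassCondition m) {f z : Fin N} (hf : f.val = 0) (hz : z.val + 1 = N)
    {x : Fin N → ℝ} (hx : Monotone x) (hxz : x f < x z) :
    0 < relForm m Finset.univ x x := by
  rw [← relForm_sub_const m Finset.univ hm.totalMass_ne_zero x (x f)]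
  set L := x z - x f with hL
  have hL0 : 0 < L := sub_pos.2 hxz
  have hy0 : ∀ l, 0 ≤ x l - x f := fun l => sub_nonneg.2 (hx (Fin.le_def.2 (by omega)))
  have hyL : ∀ l, x l - x f ≤ L := fun l =>
    sub_le_sub_right (hx (Fin.le_def.2 (by have := l.isLt; omega))) _
  have hinner : ∀ l, l ≠ f → l ≠ z → m l < 0 := fun l h1 h2 => by
    have h1' : l.val ≠ f.val := fun h => h1 (Fin.ext h)
    have h2' : l.val ≠ z.val := fun h => h2 (Fin.ext h)
    exact hm.inner_neg l (by omega) (by have := l.isLt; omega)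
  set p := ∑ l, m l * (x l - x f) with hp
  -- With origin at the first particle, inner particles have negative mass and lie in `[0, L]`, so
  -- replacing one factor by `L` lowers the sum. The form is thus at least `L * p - p ^ 2 / M = (p /
  -- M) * (L * M - p)`; both factors are shown to be positive.
  have hQ : L * p ≤ ∑ l, m l * (x l - x f) * (x l - x f) := by
    rw [hp, Finset.mul_sum]
    refine Finset.sum_le_sum fun l _ => ?_
    by_cases h1 : l = f
    · simp [h1]
    by_cases h2 : l = z
    · rw [h2, ← hL]; linarith
    · nlinarith [mul_nonneg (neg_nonneg.2 (hinner l h1 h2).le)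
        (mul_nonneg (hy0 l) (sub_nonneg.2 (hyL l)))]
  have hLM : 0 < L * totalMass m - p := by
    have e : L * totalMass m - p = ∑ l, m l * (L - (x l - x f)) := by
      rw [hp, totalMass, Finset.mul_sum, ← Finset.sum_sub_distrib]
      exact Finset.sum_congr rfl fun l _ => by ring
    rw [e, ← Finset.sum_filter_add_sum_filter_not _ (fun i : Fin N => i.val + 1 < N)]
    have e2 : ∑ l : Fin N with ¬l.val + 1 < N, m l * (L - (x l - x f)) = 0 :=
      Finset.sum_eq_zero fun l hl => by
        simp only [Finset.mem_filter] at hl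
        have : l = z := Fin.ext (by have := l.isLt; omega)
        rw [this, ← hL, sub_self, mul_zero]
    have e3 : L * ∑ i : Fin N with i.val + 1 < N, m i ≤
        ∑ l : Fin N with l.val + 1 < N, m l * (L - (x l - x f)) := by
      rw [Finset.mul_sum]
      refine Finset.sum_le_sum fun l hl => ?_
      simp only [Finset.mem_filter] at hl
      by_cases h1 : l = f
      · simp [h1, mul_comm]
      · have h2 : l ≠ z := fun h => by rw [h] at hl; omega
        nlinarith [mul_nonneg (neg_nonneg.2 (hinner l h1 h2).le) (hy0 l)]
    have := mul_pos hL0 hm.left_pos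
    linarith
  have hpM : 0 < p / totalMass m := by
    have e : p = ∑ l : Fin N with 0 < l.val, m l * (x l - x f) := by
      rw [hp, ← Finset.sum_filter_add_sum_filter_not _ (fun i : Fin N => 0 < i.val),
        add_eq_left]
      refine Finset.sum_eq_zero fun l hl => ?_
      simp only [Finset.mem_filter] at hl
      rw [show l = f from Fin.ext (by omega), sub_self, mul_zero]
    rcases lt_or_gt_of_ne hm.totalMass_ne_zero with hM | hM
    · refine div_pos_of_neg_of_neg ?_ hM
      rw [e]
      have hzmem : z ∈ Finset.univ.filter (fun i : Fin N => 0 < i.val) := by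
        have : f.val ≠ z.val := fun h => hxz.ne (by rw [Fin.ext h])
        simp only [Finset.mem_filter, Finset.mem_univ, true_and]
        omega
      refine Finset.sum_neg' (fun l hl => ?_) ⟨z, hzmem, ?_⟩
      · simp only [Finset.mem_filter] at hl
        exact mul_nonpos_of_nonpos_of_nonneg (hm.neg_of_totalMass_neg hM hl.2).le (hy0 l)
      · simp only [Finset.mem_filter] at hzmem
        exact mul_neg_of_neg_of_pos (hm.neg_of_totalMass_neg hM hzmem.2) hL0
    · refine div_pos ?_ hM
      refine (mul_pos hL0 (hm.right_mass_pos hM)).trans_le ?_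
      rw [e, Finset.mul_sum]
      refine Finset.sum_le_sum fun l hl => ?_
      simp only [Finset.mem_filter] at hl
      by_cases h2 : l = z
      · rw [h2, ← hL, mul_comm]
      · have h1 : l ≠ f := fun h => by rw [h] at hl; omega
        nlinarith [mul_nonneg (neg_nonneg.2 (hinner l h1 h2).le) (sub_nonneg.2 (hyL l))]
  have hfin : L * p - p * p / totalMass m = p / totalMass m * (L * totalMass m - p) := by
    field_simp [hm.totalMass_ne_zero]
  rw [relForm]
  have := mul_pos hpM hLM
  simp only [totalMass] at *
  linarith

/-- There is a hyperplane, containing the translations, on which the relative mass form is negative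
definite modulo translations. -/
theorem exists_hyperplane (hm : MassCondition m) (hN : 0 < N) :
    ∃ φ : (Fin N → ℝ) →ₗ[ℝ] ℝ, ∀ v, φ v = 0 →
      relForm m Finset.univ v v ≤ 0 ∧ (relForm m Finset.univ v v = 0 → ∀ i j, v i = v j) := by
  let f : Fin N := ⟨0, hN⟩
  let z : Fin N := ⟨N - 1, by omega⟩
  have key : ∀ v : Fin N → ℝ, (∀ l, l ≠ f → m l < 0 ∨ v l = v f) →
      0 ≤ (∑ l, m l * (v l - v f)) * (∑ l, m l * (v l - v f)) / ∑ l, m l →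
      relForm m Finset.univ v v ≤ 0 ∧ (relForm m Finset.univ v v = 0 → ∀ i j, v i = v j) := by
    intro v h1 h2
    have hn : ∀ l, m l * (v l - v f) * (v l - v f) ≤ 0 := fun l => by
      by_cases hl : l = f
      · simp [hl]
      rcases h1 l hl with h | h
      · nlinarith [mul_nonneg (neg_nonneg.2 h.le) (sq_nonneg (v l - v f))]
      · simp [h]
    have hs := Finset.sum_nonpos (s := Finset.univ) fun l _ => hn l
    rw [← relForm_sub_const m Finset.univ hm.totalMass_ne_zero v (v f), relForm]
    refine ⟨by linarith, fun h0 => ?_⟩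
    have hs0 : ∑ l, m l * (v l - v f) * (v l - v f) = 0 := by linarith
    have hall : ∀ l, v l = v f := fun l => by
      have := (Finset.sum_eq_zero_iff_of_nonpos fun l _ => hn l).1 hs0 l (Finset.mem_univ l)
      by_cases hl : l = f
      · rw [hl]
      rcases h1 l hl with h | h
      · simpa [h.ne, sub_eq_zero] using this
      · exact h
    intro i j
    rw [hall i, hall j]
  -- For `M < 0` all masses but the first are negative, and the hyperplane is chosen to cancel the
  -- correction term. For `M > 0` the correction has the right sign, and the hyperplane makes the
  -- two end velocities equal so that only inner masses contribute.
  rcases lt_or_gt_of_ne hm.totalMass_ne_zero with hM | hM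
  · refine ⟨∑ l, m l • ((LinearMap.proj l : (Fin N → ℝ) →ₗ[ℝ] ℝ) - LinearMap.proj f), fun v hv => key v (fun l hl => ?_) ?_⟩
    · exact Or.inl (hm.neg_of_totalMass_neg hM (Nat.pos_of_ne_zero fun h => hl (Fin.ext h)))
    · have : ∑ l, m l * (v l - v f) = 0 := by simpa using hv
      simp [this]
  · refine ⟨(LinearMap.proj z : (Fin N → ℝ) →ₗ[ℝ] ℝ) - LinearMap.proj f, fun v hv => key v (fun l hl => ?_) ?_⟩
    · by_cases hlz : l = z
      · right
        rw [hlz]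
        simpa [sub_eq_zero] using hv
      · left
        refine hm.inner_neg l (Nat.pos_of_ne_zero fun h => hl (Fin.ext h)) ?_
        have : l.val ≠ N - 1 := fun h => hlz (Fin.ext h)
        have := l.isLt
        omega
    · exact div_nonneg (mul_self_nonneg _) hM.le

end MassCondition

/-! ### The signature of the mass form -/

theorem massForm_apply (m y z : Fin N → ℝ) : massForm m y z = ∑ i, y i * m i * z i := rfl

theorem mem_zeroMomentum {m x : Fin N → ℝ} : x ∈ zeroMomentum m ↔ ∑ i, m i * x i = 0 := Iff.rfl

theorem massForm_comm (m y z : Fin N → ℝ) : massForm m y z = massForm m z y := by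
  simp only [massForm_apply]
  exact Finset.sum_congr rfl fun i _ => by ring

theorem massForm_self_eq_relForm {m x : Fin N → ℝ} (hx : x ∈ zeroMomentum m) :
    massForm m x x = relForm m Finset.univ x x := by
  rw [mem_zeroMomentum] at hx
  rw [massForm_apply, relForm, hx]
  simp only [zero_mul, zero_div, sub_zero]
  exact Finset.sum_congr rfl fun i _ => by ring

theorem sub_momentum_mem_zeroMomentum {m : Fin N → ℝ} (hM : totalMass m ≠ 0) (x : Fin N → ℝ) :
    (fun i => x i - momentum m x / totalMass m) ∈ zeroMomentum m := by
  simp only [mem_zeroMomentum, mul_sub, Finset.sum_sub_distrib, ← Finset.sum_mul]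
  rw [momentum, totalMass] at *
  field_simp
  ring

theorem energy_eq_relForm {m : Fin N → ℝ} (hM : totalMass m ≠ 0) (v : Fin N → ℝ) :
    energy m v = relForm m Finset.univ v v / 2 := by
  rw [energy, kineticEnergy, massForm_self_eq_relForm (sub_momentum_mem_zeroMomentum hM v),
    relForm_sub_const m _ hM]

theorem finrank_zeroMomentum {m : Fin N → ℝ} (hM : totalMass m ≠ 0) :
    Module.finrank ℝ (zeroMomentum m) + 1 = N := by
  let ψ : Module.Dual ℝ (Fin N → ℝ) := ∑ l, m l • (LinearMap.proj l : (Fin N → ℝ) →ₗ[ℝ] ℝ)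
  have hψ : ∀ x, ψ x = ∑ l, m l * x l := fun x => by simp [ψ]
  have hk : zeroMomentum m = LinearMap.ker ψ := by
    ext x
    rw [mem_zeroMomentum, LinearMap.mem_ker, hψ]
  rw [hk, Module.Dual.finrank_ker_add_one_of_ne_zero]
  · simp
  · intro h0
    have := hψ fun _ => 1
    rw [h0] at this
    simp only [LinearMap.zero_apply, mul_one] at this
    exact hM this.symm

theorem eq_zero_of_mem_zeroMomentum {m x : Fin N → ℝ} (hM : totalMass m ≠ 0)
    (hx : x ∈ zeroMomentum m) (hc : ∀ i j, x i = x j) : x = 0 := by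
  funext i
  rw [mem_zeroMomentum, Finset.sum_congr rfl fun j _ => by rw [hc j i], ← Finset.sum_mul] at hx
  exact (mul_eq_zero.1 hx).resolve_left hM

theorem MassCondition.hasSignature {m : Fin N → ℝ} (hm : MassCondition m) (hN : 3 ≤ N) :
    HasSignature ((massForm m).restrict (zeroMomentum m)) 1 (N - 2) := by
  have hM := hm.totalMass_ne_zero
  set B := (massForm m).restrict (zeroMomentum m) with hB
  have hBs : ∀ x y, B x y = massForm m x y := fun _ _ => rfl
  set Q := B.toQuadraticMap with hQ
  have hQa : ∀ x : zeroMomentum m, Q x = relForm m Finset.univ x x := fun x => by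
    rw [hQ, LinearMap.BilinMap.toQuadraticMap_apply, hBs, massForm_self_eq_relForm x.2]
  have hdim := finrank_zeroMomentum hM
  -- The equally spaced configuration, moved to its center of mass, is a positive vector.
  have hpos : 1 ≤ sigPos Q := by
    let x : Fin N → ℝ := fun i => (i.val : ℝ)
    have hx : Monotone x := fun i j hij => Nat.cast_le.2 (Fin.le_def.1 hij)
    have hxp : 0 < relForm m Finset.univ x x := by
      refine hm.relForm_pos (f := ⟨0, by omega⟩) (z := ⟨N - 1, by omega⟩) rfl
        (by simp only; omega) hx ?_
      simp only [x, Nat.cast_lt]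
      omega
    let u : zeroMomentum m := ⟨_, sub_momentum_mem_zeroMomentum hM x⟩
    have hu : 0 < Q u := by
      rw [hQa, relForm_sub_const m _ hM]
      exact hxp
    have hu0 : u ≠ 0 := fun h => by simp [h] at hu
    rw [← finrank_span_singleton (K := ℝ) hu0]
    refine le_sigPos_of_posDef Q fun y hy => ?_
    obtain ⟨c, hc⟩ := Submodule.mem_span_singleton.1 y.2
    have hc0 : c ≠ 0 := fun h => hy (Subtype.ext (by rw [← hc, h, zero_smul]; rfl))
    rw [QuadraticMap.restrict_apply, ← hc, QuadraticMap.map_smul, smul_eq_mul]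
    exact mul_pos (mul_self_pos.2 hc0) hu
  have hneg : N - 2 ≤ sigNeg Q := by
    obtain ⟨φ, hφ⟩ := hm.exists_hyperplane (by omega)
    let φ' := φ ∘ₗ (zeroMomentum m).subtype
    have h1 := LinearMap.finrank_range_add_finrank_ker φ'
    have h2 := (LinearMap.range φ').finrank_le
    rw [Module.finrank_self] at h2
    refine le_trans (by omega) (le_sigNeg_of_negDef Q (V := LinearMap.ker φ') fun y hy => ?_)
    have hφy : φ (y : zeroMomentum m) = 0 := LinearMap.mem_ker.1 y.2
    obtain ⟨h3, h4⟩ := hφ _ hφy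
    rw [QuadraticMap.restrict_apply, neg_apply, hQa, neg_pos]
    refine h3.lt_of_ne fun h0 => hy ?_
    have := eq_zero_of_mem_zeroMomentum hM (y : zeroMomentum m).2 (h4 h0)
    exact Subtype.ext (Subtype.ext this)
  -- The lower bounds `1` and `N - 2` already exhaust the dimension `N - 1`, so both are equalities
  -- and the radical is zero.
  have hsum := QuadraticForm.sigPos_add_sigNeg_add_radical (Q := Q)
  have hrad : Q.radical = ⊥ := Submodule.finrank_eq_zero.1 (by omega)
  have hsep : ∀ x, (∀ y, B x y = 0) → x = 0 := fun x hx => by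
    rw [← Submodule.mem_bot ℝ, ← hrad, QuadraticMap.mem_radical_iff']
    refine ⟨hx x, fun y => ?_⟩
    have hyx : B y x = 0 := (massForm_comm m _ _).trans (hx y)
    simp only [hQ, LinearMap.BilinMap.toQuadraticMap_apply, map_add, LinearMap.add_apply, hx, hyx,
      zero_add]
  have hp : sigPos Q = 1 := by omega
  have hn : sigNeg Q = N - 2 := by omega
  exact ⟨⟨hsep, fun y hy => hsep y fun x => (massForm_comm m _ _).trans (hy x)⟩, hp, hn⟩

/-! ### One-sided velocities -/

section Velocity

variable {x : ℝ → Fin N → ℝ} {t : ℝ} {v w : Fin N → ℝ}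

theorem VelocityAfter.unique (h : VelocityAfter x t v) (h' : VelocityAfter x t w) : v = w := by
  obtain ⟨s, ⟨h1, h2⟩, h3⟩ := ((h.and h').and self_mem_nhdsWithin).exists
  have h4 : s - t ≠ 0 := (sub_pos.2 h3).ne'
  exact smul_right_injective _ h4 (add_left_cancel (h1.symm.trans h2))

theorem VelocityBefore.unique (h : VelocityBefore x t v) (h' : VelocityBefore x t w) : v = w := by
  obtain ⟨s, ⟨h1, h2⟩, h3⟩ := ((h.and h').and self_mem_nhdsWithin).exists
  have h4 : s - t ≠ 0 := (sub_neg.2 h3).ne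
  exact smul_right_injective _ h4 (add_left_cancel (h1.symm.trans h2))

/-- The motion is uniform with velocity `w` around the time `t`. -/
theorem velocity_of_eventually_eq {y : Fin N → ℝ} (h : ∀ᶠ r in 𝓝 t, x r = y + r • w) :
    x t - t • w = y ∧ VelocityBefore x t w ∧ VelocityAfter x t w := by
  have ht : x t = y + t • w := h.self_of_nhds
  have h' : ∀ᶠ r in 𝓝 t, x r = x t + (r - t) • w := by
    filter_upwards [h] with r hr
    rw [hr, ht, sub_smul]
    abel
  exact ⟨by rw [ht, add_sub_cancel_right], h'.filter_mono nhdsWithin_le_nhds,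
    h'.filter_mono nhdsWithin_le_nhds⟩

theorem VelocityAfter.eventually (h : VelocityAfter x t w) :
    ∀ᶠ s in 𝓝[>] t, x s - s • w = x t - t • w ∧ VelocityBefore x s w ∧ VelocityAfter x s w := by
  filter_upwards [eventually_eventually_nhdsWithin.2 h, self_mem_nhdsWithin] with s hs hst
  rw [isOpen_Ioi.nhdsWithin_eq hst] at hs
  refine velocity_of_eventually_eq ?_
  filter_upwards [hs] with r hr
  rw [hr, sub_smul]
  abel

theorem VelocityBefore.eventually (h : VelocityBefore x t w) :
    ∀ᶠ s in 𝓝[<] t, x s - s • w = x t - t • w ∧ VelocityBefore x s w ∧ VelocityAfter x s w := by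
  filter_upwards [eventually_eventually_nhdsWithin.2 h, self_mem_nhdsWithin] with s hs hst
  rw [isOpen_Iio.nhdsWithin_eq hst] at hs
  refine velocity_of_eventually_eq ?_
  filter_upwards [hs] with r hr
  rw [hr, sub_smul]
  abel

theorem VelocityAfter.tendsto (h : VelocityAfter x t w) : Tendsto x (𝓝[>] t) (𝓝 (x t)) := by
  have h1 : Tendsto (fun s : ℝ => x t + (s - t) • w) (𝓝 t) (𝓝 (x t + (t - t) • w)) :=
    (by fun_prop : Continuous fun s : ℝ => x t + (s - t) • w).tendsto t
  rw [sub_self, zero_smul, add_zero] at h1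
  exact (h1.mono_left nhdsWithin_le_nhds).congr' (h.mono fun s hs => hs.symm)

theorem VelocityBefore.tendsto (h : VelocityBefore x t w) : Tendsto x (𝓝[<] t) (𝓝 (x t)) := by
  have h1 : Tendsto (fun s : ℝ => x t + (s - t) • w) (𝓝 t) (𝓝 (x t + (t - t) • w)) :=
    (by fun_prop : Continuous fun s : ℝ => x t + (s - t) • w).tendsto t
  rw [sub_self, zero_smul, add_zero] at h1
  exact (h1.mono_left nhdsWithin_le_nhds).congr' (h.mono fun s hs => hs.symm)

/-- A function of the velocity `w` and of the extrapolated configuration `x t - t • w` at the time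
zero that is preserved by the collisions is a constant of motion. -/
theorem constant_of_motion {α : Type*} {m : Fin N → ℝ} {J : Set ℝ} (hJo : IsOpen J)
    (hJ : IsPreconnected J)
    (hlaw : ∀ t ∈ J, ∃ v w, VelocityBefore x t v ∧ VelocityAfter x t w ∧ CollisionLaw m (x t) v w)
    (F : (Fin N → ℝ) → (Fin N → ℝ) → α)
    (hF : ∀ t ∈ J, ∀ v w, VelocityBefore x t v → VelocityAfter x t w → CollisionLaw m (x t) v w →
      F (x t - t • v) v = F (x t - t • w) w)
    {s : ℝ} (ht : t ∈ J) (hs : s ∈ J) (hv : VelocityAfter x t v) (hw : VelocityAfter x s w) :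
    F (x t - t • v) v = F (x s - s • w) w := by
  refine hJ.induction₂ (fun t s => ∀ v w, VelocityAfter x t v → VelocityAfter x s w →
    F (x t - t • v) v = F (x s - s • w) w) (fun t ht => ?_) (fun t r s _ hr _ h1 h2 v w hv hw => ?_)
    (fun t s _ _ h v w hv hw => (h w v hw hv).symm) ht hs v w hv hw
  · obtain ⟨v, w, hv, hw, hvw⟩ := hlaw t ht
    -- Local constancy is checked on the left, on the right and at `t`: the extrapolation to time
    -- zero does not change in free flight, and `hF` joins the two sides.
    rw [hJo.nhdsWithin_eq ht, ← nhdsNE_sup_pure t, ← nhdsLT_sup_nhdsGT]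
    refine eventually_sup.2 ⟨eventually_sup.2 ⟨?_, ?_⟩, ?_⟩
    · filter_upwards [hv.eventually] with s hs w1 w2 hw1 hw2
      rw [hw1.unique hw, hw2.unique hs.2.2, hs.1, hF t ht v w hv hw hvw]
    · filter_upwards [hw.eventually] with s hs w1 w2 hw1 hw2
      rw [hw1.unique hw, hw2.unique hs.2.2, hs.1]
    · refine eventually_pure.2 fun w1 w2 hw1 hw2 => ?_
      rw [hw1.unique hw2]
  · obtain ⟨-, u, -, hu, -⟩ := hlaw r hr
    rw [h1 v u hv hu, h2 u w hu hw]

/-! ### Collisions -/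

theorem Collide.symm {i j : Fin N} (h : Collide x i j t) : Collide x j i t :=
  ⟨h.1.symm, h.2.mono fun _ hs => hs.symm⟩

theorem Collide.velocity_ne {i j : Fin N} (h : Collide x i j t) :
    (VelocityBefore x t v → v i ≠ v j) ∧ (VelocityAfter x t w → w i ≠ w j) := by
  refine ⟨fun hv hij => ?_, fun hw hij => ?_⟩
  · obtain ⟨s, h1, h2⟩ := (hv.and (h.2.filter_mono (nhdsLT_le_nhdsNE t))).exists
    exact h2 (by simp [h1, h.1, hij])
  · obtain ⟨s, h1, h2⟩ := (hw.and (h.2.filter_mono (nhdsGT_le_nhdsNE t))).exists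
    exact h2 (by simp [h1, h.1, hij])

theorem collide_of_velocity_ne {i j : Fin N} (hq : x t i = x t j) (hv : VelocityBefore x t v)
    (hw : VelocityAfter x t w) (hvij : v i ≠ v j) (hwij : w i ≠ w j) : Collide x i j t := by
  refine ⟨hq, ?_⟩
  rw [← nhdsLT_sup_nhdsGT]
  refine eventually_sup.2 ⟨?_, ?_⟩
  · filter_upwards [hv, self_mem_nhdsWithin] with s hs hst h
    simp only [hs, Pi.add_apply, Pi.smul_apply, smul_eq_mul, hq, add_right_inj] at h
    exact hvij (mul_left_cancel₀ (sub_neg.2 hst).ne h)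
  · filter_upwards [hw, self_mem_nhdsWithin] with s hs hst h
    simp only [hs, Pi.add_apply, Pi.smul_apply, smul_eq_mul, hq, add_right_inj] at h
    exact hwij (mul_left_cancel₀ (sub_pos.2 hst).ne' h)

end Velocity

/-- In an ordered configuration without contacts of three particles, only adjacent particles can
be in contact. -/
theorem CollisionLaw.adjacent {m q v w : Fin N → ℝ} (h : CollisionLaw m q v w) (hq : Monotone q)
    {i j : Fin N} (hij : i < j) (he : q i = q j) : i.val + 1 = j.val := by
  by_contra hne
  have hlt := Fin.lt_def.1 hij
  have hj := j.isLt
  let k : Fin N := ⟨i.val + 1, by omega⟩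
  have hik : i < k := Fin.lt_def.2 (Nat.lt_succ_self _)
  have hkj : k < j := Fin.lt_def.2 (by simp only [k]; omega)
  have h1 := hq hik.le
  have h2 := hq hkj.le
  exact h.no_triple i k j hik.ne hkj.ne hij.ne ⟨by linarith, by linarith⟩

/-- Particles in contact are adjacent, and since `N ≥ 3` an adjacent pair misses an end particle. -/
theorem CollisionLaw.mass_add_ne_zero {m q v w : Fin N → ℝ} (h : CollisionLaw m q v w)
    (hm : MassCondition m) (hN : 3 ≤ N) (hq : Monotone q) {i j : Fin N} (hij : i ≠ j)
    (he : q i = q j) : m i + m j ≠ 0 := by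
  rcases lt_or_gt_of_ne hij with hlt | hlt
  · have := h.adjacent hq hlt he
    exact hm.add_ne_zero hij (by omega)
  · have := h.adjacent hq hlt he.symm
    exact hm.add_ne_zero hij (by omega)

/-- A contact with different velocities reverses the relative velocity, so the particles are apart
on both sides and the contact is a collision. -/
theorem CollisionLaw.velocity_eq {m v w : Fin N → ℝ} {x : ℝ → Fin N → ℝ} {t : ℝ}
    (h : CollisionLaw m (x t) v w) (hm : MassCondition m) (hN : 3 ≤ N) (hq : Monotone (x t))
    (hv : VelocityBefore x t v) (hw : VelocityAfter x t w) {i j : Fin N} (he : x t i = x t j)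
    (hc : ¬Collide x i j t) : v i = v j := by
  by_cases hij : i = j
  · rw [hij]
  by_contra hne
  refine hc (collide_of_velocity_ne he hv hw hne fun hwij => hne ?_)
  have := h.sub_eq_neg hij he (h.mass_add_ne_zero hm hN hq hij he)
  linarith

/-! ### Conservation laws for groups of particles -/

theorem isOpen_timeInterval (a b : EReal) : IsOpen (timeInterval a b) :=
  (isOpen_lt continuous_const continuous_coe_real_ereal).inter
    (isOpen_lt continuous_coe_real_ereal continuous_const)

theorem ordConnected_timeInterval (a b : EReal) : (timeInterval a b).OrdConnected :=
  ⟨fun _ hx _ hy _ hz => ⟨hx.1.trans_le (EReal.coe_le_coe_iff.2 hz.1),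
    (EReal.coe_le_coe_iff.2 hz.2).trans_lt hy.2⟩⟩

namespace IsSolution

variable {m : Fin N → ℝ} {a b : EReal} {x : ℝ → Fin N → ℝ}

theorem zero_mem (h : IsSolution m a b x) : (0 : ℝ) ∈ timeInterval a b :=
  ⟨by simpa using h.start_neg, by simpa using h.end_pos⟩

/-- A group of particles that does not collide with the others evolves, for the relative mass
form, like a free motion. -/
theorem relForm_eq_extrapolation (h : IsSolution m a b x) (hm : MassCondition m) (hN : 3 ≤ N)
    {J : Set ℝ} (hJo : IsOpen J) (hJ : IsPreconnected J) (hJab : J ⊆ timeInterval a b)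
    {S : Finset (Fin N)} (hS : ∀ t ∈ J, ∀ i ∈ S, ∀ j ∉ S, ¬Collide x i j t)
    {t s : ℝ} {v w : Fin N → ℝ} (ht : t ∈ J) (hs : s ∈ J) (hv : VelocityAfter x t v)
    (hw : VelocityAfter x s w) :
    relForm m S v v = relForm m S w w ∧
      ∀ r : ℝ, relForm m S (x t + (r - t) • v) (x t + (r - t) • v) =
        relForm m S (x s + (r - s) • w) (x s + (r - s) • w) := by
  have key := constant_of_motion (x := x) hJo hJ (fun t ht => h.law t (hJab ht))
    (fun y w => (relForm m S w w, relForm m S y w, relForm m S y y)) (fun t ht v w hv hw hvw => by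
      have hiso : Isolated (x t) v S := fun i hi j hj he =>
        (hvw.velocity_eq hm hN (h.ordered t (hJab ht)) hv hw he.symm (hS t ht i hi j hj)).symm
      obtain ⟨h1, h2, h3⟩ := hvw.relForm_eq hiso t
      rw [h1, h2, h3])
    ht hs hv hw
  simp only [Prod.mk.injEq] at key
  obtain ⟨h1, h2, h3⟩ := key
  refine ⟨h1, fun r => ?_⟩
  have e : ∀ (q u : Fin N → ℝ) (t : ℝ), q + (r - t) • u = (q - t • u) + r • u := fun q u t => by
    rw [sub_smul]
    abel
  rw [e, e, relForm_add_smul, relForm_add_smul, h1, h2, h3]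

theorem continuousAt (h : IsSolution m a b x) {t : ℝ} (ht : t ∈ timeInterval a b) :
    ContinuousAt x t := by
  obtain ⟨v, w, hv, hw, -⟩ := h.law t ht
  exact continuousAt_iff_continuous_left'_right'.2 ⟨hv.tendsto, hw.tendsto⟩

end IsSolution

/-! ### Proper groups of particles have no collapse -/

/-- `l` is the filter of the left or of the right neighbourhoods of `e`. -/
def IsSide (l : Filter ℝ) (e : ℝ) : Prop := l = 𝓝[<] e ∨ l = 𝓝[>] e

namespace IsSide

variable {l : Filter ℝ} {e : ℝ}

theorem le (h : IsSide l e) : l ≤ 𝓝[≠] e := by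
  rcases h with rfl | rfl
  · exact nhdsLT_le_nhdsNE e
  · exact nhdsGT_le_nhdsNE e

theorem neBot (h : IsSide l e) : l.NeBot := by
  rcases h with rfl | rfl <;> infer_instance

theorem exists_Ioo (h : IsSide l e) {p : ℝ → Prop} (hp : ∀ᶠ t in l, p t) :
    ∃ c d, Set.Ioo c d ∈ l ∧ e ∉ Set.Ioo c d ∧ ∀ t ∈ Set.Ioo c d, p t := by
  rcases h with rfl | rfl
  · obtain ⟨c, hc, hcp⟩ := mem_nhdsLT_iff_exists_Ioo_subset.1 hp
    exact ⟨c, e, Ioo_mem_nhdsLT hc, fun h => lt_irrefl _ h.2, hcp⟩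
  · obtain ⟨d, hd, hdp⟩ := mem_nhdsGT_iff_exists_Ioo_subset.1 hp
    exact ⟨e, d, Ioo_mem_nhdsGT hd, fun h => lt_irrefl _ h.1, hdp⟩

end IsSide

namespace IsSolution

variable {m : Fin N → ℝ} {a b : EReal} {x : ℝ → Fin N → ℝ}

/-- The distances in a group with negative definite relative mass form are Lipschitz functions. -/
theorem lipschitzOnWith_sub (h : IsSolution m a b x) (hm : MassCondition m) (hN : 3 ≤ N)
    {c d : ℝ} (hJab : Set.Ioo c d ⊆ timeInterval a b) {S : Finset (Fin N)} (hneg : NegDefOn m S)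
    (hS : ∀ t ∈ Set.Ioo c d, ∀ i ∈ S, ∀ j ∉ S, ¬Collide x i j t) :
    ∃ C : NNReal, ∀ i ∈ S, ∀ j ∈ S, LipschitzOnWith C (fun t => x t i - x t j) (Set.Ioo c d) := by
  rcases (Set.Ioo c d).eq_empty_or_nonempty with he | ⟨t₀, ht₀⟩
  · exact ⟨0, by simp [he]⟩
  obtain ⟨-, w₀, -, hw₀, -⟩ := h.law t₀ (hJab ht₀)
  obtain ⟨-, κ, hκ, hle⟩ := hneg
  -- Definiteness applied to velocities bounds `κ * (w i - w j) ^ 2` by the conserved value of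
  -- `-relForm`.
  set C := √(-relForm m S w₀ w₀ / κ) with hC
  refine ⟨⟨C, Real.sqrt_nonneg _⟩, fun i hi j hj => LipschitzOnWith.of_dist_le_mul ?_⟩
  have key : ∀ t ∈ Set.Ioo c d, ∀ s ∈ Set.Ioo c d, t ≤ s →
      ‖(x s i - x s j) - (x t i - x t j)‖ ≤ C * (s - t) := by
    intro t ht s hs hts
    have hsub : Set.Icc t s ⊆ Set.Ioo c d := Set.Icc_subset_Ioo ht.1 hs.2
    have hvel : ∀ r, ∃ w, r ∈ Set.Ioo c d → VelocityAfter x r w := fun r => by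
      by_cases hr : r ∈ Set.Ioo c d
      · obtain ⟨-, w, -, hw, -⟩ := h.law r (hJab hr)
        exact ⟨w, fun _ => hw⟩
      · exact ⟨0, fun h => absurd h hr⟩
    choose W hW using hvel
    refine norm_image_sub_le_of_norm_deriv_right_le_segment
      (f := fun r => x r i - x r j) (f' := fun r => W r i - W r j) ?_ ?_ ?_ s
      (Set.right_mem_Icc.2 hts)
    · intro r hr
      have hc := h.continuousAt (hJab (hsub hr))
      exact (((continuous_apply i).continuousAt.comp hc).sub
        ((continuous_apply j).continuousAt.comp hc)).continuousWithinAt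
    · intro r hr
      have hr' := hW r (hsub (Set.Ico_subset_Icc_self hr))
      rw [← hasDerivWithinAt_Ioi_iff_Ici]
      have hlin : HasDerivWithinAt (fun s : ℝ => (x r i - x r j) + (s - r) * (W r i - W r j))
          (W r i - W r j) (Set.Ioi r) r := by
        simpa using ((((hasDerivAt_id r).sub_const r).mul_const
          (W r i - W r j)).const_add (x r i - x r j)).hasDerivWithinAt (s := Set.Ioi r)
      refine hlin.congr_of_eventuallyEq ?_ (by simp)
      filter_upwards [hr'] with s hs
      simp only [hs, Pi.add_apply, Pi.smul_apply, smul_eq_mul]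
      ring
    · intro r hr
      have hrJ := hsub (Set.Ico_subset_Icc_self hr)
      have he := (h.relForm_eq_extrapolation hm hN isOpen_Ioo isPreconnected_Ioo hJab hS hrJ ht₀
        (hW r hrJ) hw₀).1
      rw [Real.norm_eq_abs, hC]
      refine Real.abs_le_sqrt ?_
      rw [le_div_iff₀ hκ, ← he, mul_comm]
      exact hle _ i hi j hj
  intro t ht s hs
  rcases le_total t s with hts | hts
  · have := key t ht s hs hts
    rw [dist_comm, dist_comm t s, dist_eq_norm, Real.dist_eq, abs_of_nonneg (sub_nonneg.2 hts)]
    exact this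
  · have := key s hs t ht hts
    rw [dist_eq_norm, Real.dist_eq, abs_of_nonneg (sub_nonneg.2 hts)]
    exact this

/-- A group with negative definite relative mass form that shrinks to a point at the time `e` has
no collisions before. -/
theorem not_collide_of_tendsto (h : IsSolution m a b x) (hm : MassCondition m) (hN : 3 ≤ N)
    {l : Filter ℝ} {e : ℝ} (hl : IsSide l e) {c d : ℝ} (hmem : Set.Ioo c d ∈ l)
    (he : e ∉ Set.Ioo c d) (hJab : Set.Ioo c d ⊆ timeInterval a b) {S : Finset (Fin N)}
    (hneg : NegDefOn m S) (hS : ∀ t ∈ Set.Ioo c d, ∀ i ∈ S, ∀ j ∉ S, ¬Collide x i j t)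
    (hlim : ∀ i ∈ S, ∀ j ∈ S, Tendsto (fun t => x t i - x t j) l (𝓝 0)) :
    ∀ t ∈ Set.Ioo c d, ∀ i ∈ S, ∀ j ∈ S, ¬Collide x i j t := by
  intro t ht i hi j hj hc
  obtain ⟨-, w, -, hw, -⟩ := h.law t (hJab ht)
  have hM : ∑ k ∈ S, m k ≠ 0 := hneg.1 ⟨i, hi⟩
  have := hl.neBot
  have h1 : Tendsto (fun s => relForm m S (x s) (x s)) l (𝓝 0) := by
    have e : ∀ s, relForm m S (x s) (x s) =
        ∑ k ∈ S, m k * (x s k - x s i) * (x s k - x s i) -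
        (∑ k ∈ S, m k * (x s k - x s i)) * (∑ k ∈ S, m k * (x s k - x s i)) / ∑ k ∈ S, m k :=
      fun s => (relForm_sub_const m S hM (x s) (x s i)).symm
    simp only [e]
    have h2 : ∀ k ∈ S, Tendsto (fun s => m k * (x s k - x s i)) l (𝓝 0) := fun k hk => by
      simpa using (hlim k hk i hi).const_mul (m k)
    have h3 := tendsto_finsetSum S h2
    have h4 := tendsto_finsetSum S fun k hk => (h2 k hk).mul (hlim k hk i hi)
    simpa using h4.sub ((h3.mul h3).div_const _)
  have h2 : Tendsto (fun s => relForm m S (x s) (x s)) l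
      (𝓝 (relForm m S (x t + (e - t) • w) (x t + (e - t) • w))) := by
    have hcont : Continuous fun s : ℝ => relForm m S (x t + (s - t) • w) (x t + (s - t) • w) := by
      simp only [relForm_add_smul]
      fun_prop
    refine ((hcont.tendsto e).mono_left (hl.le.trans nhdsWithin_le_nhds)).congr' ?_
    filter_upwards [hmem] with s hs
    obtain ⟨-, u, -, hu, -⟩ := h.law s (hJab hs)
    rw [(h.relForm_eq_extrapolation hm hN isOpen_Ioo isPreconnected_Ioo hJab hS ht hs hw hu).2 s]
    simp
  have h3 := tendsto_nhds_unique h2 h1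
  obtain ⟨-, κ, hκ, hle⟩ := hneg
  have h4 := hle (x t + (e - t) • w) i hi j hj
  rw [h3, neg_zero] at h4
  have h5 : (x t i + (e - t) * w i - (x t j + (e - t) * w j)) ^ 2 = 0 :=
    le_antisymm (nonpos_of_mul_nonpos_right h4 hκ) (sq_nonneg _)
  have h6 : (e - t) * (w i - w j) = 0 := by
    have := pow_eq_zero_iff (two_ne_zero) |>.1 h5
    rw [hc.1] at this
    linarith
  refine (hc.velocity_ne (v := w)).2 hw ?_
  refine sub_eq_zero.1 ((mul_eq_zero.1 h6).resolve_left fun h0 => he ?_)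
  rwa [sub_eq_zero.1 h0]

/-- A proper group of particles that does not collide with the others has finitely many
collisions near each time. -/
theorem eventually_not_collide (h : IsSolution m a b x) (hm : MassCondition m) (hN : 3 ≤ N)
    {l : Filter ℝ} {e : ℝ} (hl : IsSide l e) (hab : ∀ᶠ t in l, t ∈ timeInterval a b)
    (S : Finset (Fin N)) : ((∀ i ∈ S, 0 < i.val) ∨ ∀ i ∈ S, i.val + 1 < N) →
    (∀ᶠ t in l, ∀ i ∈ S, ∀ j ∉ S, ¬Collide x i j t) →
    ∀ᶠ t in l, ∀ i ∈ S, ∀ j ∈ S, ¬Collide x i j t := by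
  induction S using Finset.strongInduction with
  | H S ih =>
  intro hprop hiso
  have := hl.neBot
  obtain ⟨c, d, hmem, he, hcd⟩ := hl.exists_Ioo (hab.and hiso)
  have hJab : Set.Ioo c d ⊆ timeInterval a b := fun t ht => (hcd t ht).1
  have hS := fun t ht => (hcd t ht).2
  have hneg := hm.negDefOn hprop
  obtain ⟨C, hC⟩ := h.lipschitzOnWith_sub hm hN hJab hneg hS
  have hlim : ∀ i ∈ S, ∀ j ∈ S, ∃ L, Tendsto (fun t => x t i - x t j) l (𝓝 L) := by
    intro i hi j hj
    -- The point `e` lies outside the interval; a Lipschitz extension to the whole line supplies the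
    -- limit.
    obtain ⟨g, hg, hgeq⟩ := (hC i hi j hj).extend_real
    refine ⟨g e, ((hg.continuous.tendsto e).mono_left
      (hl.le.trans nhdsWithin_le_nhds)).congr' ?_⟩
    filter_upwards [hmem] with t ht using (hgeq ht).symm
  by_cases hz : ∀ i ∈ S, ∀ j ∈ S, Tendsto (fun t => x t i - x t j) l (𝓝 0)
  · filter_upwards [hmem] with t ht
    exact h.not_collide_of_tendsto hm hN hl hmem he hJab hneg hS hz t ht
  push Not at hz
  obtain ⟨p, hp, q, hq, hpq⟩ := hz
  classical
  -- `T` is the cluster of particles merging with `p`. It contains `p` but not `q`, so `T` and `S \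
  -- T` are both smaller than `S`, and near `e` they do not touch.
  set T := S.filter fun i => Tendsto (fun t => x t i - x t p) l (𝓝 0) with hT
  have hpT : p ∈ T := by simp [hT, hp]
  have hqT : q ∉ T := fun h0 => hpq <| by
    simpa using (Finset.mem_filter.1 h0).2.neg
  have hTS : T ⊂ S := Finset.ssubset_iff_subset_ne.2
    ⟨Finset.filter_subset _ _, fun h0 => hqT (h0 ▸ hq)⟩
  have hTS' : S \ T ⊂ S := Finset.ssubset_iff_subset_ne.2
    ⟨Finset.sdiff_subset, fun h0 => (Finset.mem_sdiff.1 (h0.symm ▸ hp)).2 hpT⟩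
  have hsep : ∀ᶠ t in l, ∀ i ∈ T, ∀ j ∈ S \ T, x t i ≠ x t j := by
    rw [eventually_all_finset]
    intro i hi
    rw [eventually_all_finset]
    intro j hj
    rw [Finset.mem_sdiff] at hj
    obtain ⟨L, hL⟩ := hlim j hj.1 i (Finset.mem_filter.1 hi).1
    have hL0 : L ≠ 0 := fun h0 => hj.2 <| Finset.mem_filter.2 ⟨hj.1, by
      simpa [h0] using hL.add (Finset.mem_filter.1 hi).2⟩
    filter_upwards [hL.eventually_ne hL0] with t ht h0
    exact ht (by rw [h0, sub_self])
  have hprop1 := ih T hTS (hprop.imp (fun h i hi => h i (hTS.1 hi)) fun h i hi => h i (hTS.1 hi)) <| by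
    filter_upwards [hiso, hsep] with t h1 h2 i hi j hj hc
    by_cases hjS : j ∈ S
    · exact h2 i hi j (Finset.mem_sdiff.2 ⟨hjS, hj⟩) hc.1
    · exact h1 i (hTS.1 hi) j hjS hc
  have hprop2 := ih (S \ T) hTS'
    (hprop.imp (fun h i hi => h i (hTS'.1 hi)) fun h i hi => h i (hTS'.1 hi)) <| by
    filter_upwards [hiso, hsep] with t h1 h2 i hi j hj hc
    by_cases hjS : j ∈ S
    · have hjT : j ∈ T := by
        by_contra hjT
        exact hj (Finset.mem_sdiff.2 ⟨hjS, hjT⟩)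
      exact h2 j hjT i hi hc.1.symm
    · exact h1 i (hTS'.1 hi) j hjS hc
  filter_upwards [hprop1, hprop2, hsep] with t h1 h2 h3 i hi j hj hc
  by_cases hiT : i ∈ T <;> by_cases hjT : j ∈ T
  · exact h1 i hiT j hjT hc
  · exact h3 i hiT j (Finset.mem_sdiff.2 ⟨hj, hjT⟩) hc.1
  · exact h3 j hjT i (Finset.mem_sdiff.2 ⟨hi, hiT⟩) hc.1.symm
  · exact h2 i (Finset.mem_sdiff.2 ⟨hi, hiT⟩) j (Finset.mem_sdiff.2 ⟨hj, hjT⟩) hc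

end IsSolution

/-! ### Every collapse is global -/

theorem tendsto_nhdsLT_of_strictMono {t : ℕ → ℝ} {s : ℝ} (ht : StrictMono t)
    (hs : Tendsto t atTop (𝓝 s)) : Tendsto t atTop (𝓝[<] s) :=
  tendsto_nhdsWithin_iff.2 ⟨hs, Eventually.of_forall fun n =>
    (ht n.lt_succ_self).trans_le (ht.monotone.ge_of_tendsto hs _)⟩

theorem tendsto_nhdsGT_of_strictAnti {t : ℕ → ℝ} {s : ℝ} (ht : StrictAnti t)
    (hs : Tendsto t atTop (𝓝 s)) : Tendsto t atTop (𝓝[>] s) :=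
  tendsto_nhdsWithin_iff.2 ⟨hs, Eventually.of_forall fun n =>
    (ht.antitone.le_of_tendsto hs _).trans_lt (ht n.lt_succ_self)⟩

/-- A collapse is an accumulation of collisions on one side. -/
theorem HasCollapse.exists_isSide {a b : EReal} {x : ℝ → Fin N → ℝ} {s : ℝ}
    (h : HasCollapse a b x s) : ∃ l, IsSide l s ∧ (∀ᶠ t in l, t ∈ timeInterval a b) ∧
      ∃ᶠ t in l, ∃ i j, i ≠ j ∧ Collide x i j t := by
  obtain ⟨t, hmono | hanti, hlim, ht⟩ := h
  · have hl := tendsto_nhdsLT_of_strictMono hmono hlim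
    refine ⟨𝓝[<] s, Or.inl rfl, ?_, hl.frequently (Frequently.of_forall fun n => (ht n).2)⟩
    have h0 := (tendsto_nhdsWithin_iff.1 hl).2.exists
    obtain ⟨k, hk⟩ := h0
    filter_upwards [Ioo_mem_nhdsLT hk] with r hr
    obtain ⟨n, hn⟩ := (hlim.eventually (lt_mem_nhds hr.2)).exists
    exact (ordConnected_timeInterval a b).out (ht k).1 (ht n).1 ⟨hr.1.le, hn.le⟩
  · have hl := tendsto_nhdsGT_of_strictAnti hanti hlim
    refine ⟨𝓝[>] s, Or.inr rfl, ?_, hl.frequently (Frequently.of_forall fun n => (ht n).2)⟩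
    have h0 := (tendsto_nhdsWithin_iff.1 hl).2.exists
    obtain ⟨k, hk⟩ := h0
    filter_upwards [Ioo_mem_nhdsGT hk] with r hr
    obtain ⟨n, hn⟩ := (hlim.eventually (gt_mem_nhds hr.1)).exists
    exact (ordConnected_timeInterval a b).out (ht n).1 (ht k).1 ⟨hn.le, hr.2.le⟩

theorem IsSolution.adjacent_of_collide {m : Fin N → ℝ} {a b : EReal} {x : ℝ → Fin N → ℝ}
    (h : IsSolution m a b x) {t : ℝ} (ht : t ∈ timeInterval a b) {i j : Fin N} (hij : i < j)
    (hc : Collide x i j t) : i.val + 1 = j.val := by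
  obtain ⟨v, w, -, -, hvw⟩ := h.law t ht
  exact hvw.adjacent (h.ordered t ht) hij hc.1

theorem IsSolution.hasGlobalCollapse {m : Fin N → ℝ} {a b : EReal} {x : ℝ → Fin N → ℝ}
    (h : IsSolution m a b x) (hm : MassCondition m) (hN : 3 ≤ N) {s : ℝ}
    (hs : HasCollapse a b x s) : HasGlobalCollapse a b x s := by
  refine ⟨hs, fun i j hij => ?_⟩
  obtain ⟨l, hl, hab, hfreq⟩ := hs.exists_isSide
  refine Frequently.filter_mono ?_ hl.le
  by_contra hcon
  rw [not_frequently] at hcon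
  -- If the pair `i, j` stops colliding on the side where the collapse occurs, the particles up to
  -- `i` and those from `j` on are isolated proper groups.
  set S := Finset.univ.filter fun k : Fin N => k.val ≤ i.val with hS
  have hcross : ∀ᶠ t in l, ∀ k ∈ S, ∀ k' ∉ S, ¬Collide x k k' t := by
    filter_upwards [hab, hcon] with t ht hnc k hk k' hk' hc
    simp only [hS, Finset.mem_filter, Finset.mem_univ, true_and, not_le] at hk hk'
    have := h.adjacent_of_collide ht (Fin.lt_def.2 (by omega)) hc
    rw [show k = i from Fin.ext (by omega), show k' = j from Fin.ext (by omega)] at hc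
    exact hnc ⟨ht, hc⟩
  have h1 := h.eventually_not_collide hm hN hl hab S
    (Or.inr fun k hk => by
      simp only [hS, Finset.mem_filter, Finset.mem_univ, true_and] at hk
      have := j.isLt
      omega) hcross
  have h2 := h.eventually_not_collide hm hN hl hab Sᶜ
    (Or.inl fun k hk => by
      simp only [hS, Finset.mem_compl, Finset.mem_filter, Finset.mem_univ, true_and] at hk
      omega) <| by
    filter_upwards [hcross] with t ht k hk k' hk' hc
    exact ht k' (by simpa using hk') k (by simpa using hk) hc.symm
  refine hfreq ?_
  filter_upwards [hcross, h1, h2] with t h0 h1 h2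
  rintro ⟨k, k', -, hc⟩
  by_cases hk : k ∈ S <;> by_cases hk' : k' ∈ S
  · exact h1 k hk k' hk' hc
  · exact h0 k hk k' hk' hc
  · exact h0 k' hk' k hk hc.symm
  · exact h2 k (by simpa using hk) k' (by simpa using hk') hc

/-! ### Accumulation of collisions at the ends of the time interval -/

/-- On its side, `e` is the supremum or infimum of the set of collision times without belonging to
it, which yields a strictly monotone sequence. -/
theorem hasCollapse_of_frequently {a b : EReal} {x : ℝ → Fin N → ℝ} {l : Filter ℝ} {e : ℝ}
    (hl : IsSide l e)
    (h : ∃ᶠ t in l, t ∈ timeInterval a b ∧ ∃ i j, i ≠ j ∧ Collide x i j t) :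
    HasCollapse a b x e := by
  rcases hl with rfl | rfl
  · set A := {t | (t ∈ timeInterval a b ∧ ∃ i j, i ≠ j ∧ Collide x i j t) ∧ t < e} with hA
    have hf : ∃ᶠ t in 𝓝[<] e, t ∈ A := h.and_eventually self_mem_nhdsWithin
    have hlub : IsLUB A e := isLUB_of_mem_closure (fun t ht => ht.2.le)
      (mem_closure_iff_frequently.2 (hf.filter_mono nhdsWithin_le_nhds))
    obtain ⟨t, h1, -, h2, h3⟩ := hlub.exists_seq_strictMono_tendsto_of_notMem
      (fun he => lt_irrefl _ he.2) hf.exists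
    exact ⟨t, Or.inl h1, h2, fun n => (h3 n).1⟩
  · set A := {t | (t ∈ timeInterval a b ∧ ∃ i j, i ≠ j ∧ Collide x i j t) ∧ e < t} with hA
    have hf : ∃ᶠ t in 𝓝[>] e, t ∈ A := h.and_eventually self_mem_nhdsWithin
    have hglb : IsGLB A e := isGLB_of_mem_closure (fun t ht => ht.2.le)
      (mem_closure_iff_frequently.2 (hf.filter_mono nhdsWithin_le_nhds))
    obtain ⟨t, h1, -, h2, h3⟩ := hglb.exists_seq_strictAnti_tendsto_of_notMem
      (fun he => lt_irrefl _ he.2) hf.exists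
    exact ⟨t, Or.inr h1, h2, fun n => (h3 n).1⟩

/-- Without accumulation of collisions, the motion is uniform near each time. -/
theorem IsSolution.eventually_uniform {m : Fin N → ℝ} {a b : EReal} {x : ℝ → Fin N → ℝ}
    (h : IsSolution m a b x) (hm : MassCondition m) (hN : 3 ≤ N) {l : Filter ℝ} {e : ℝ}
    (hl : IsSide l e) (hab : ∀ᶠ t in l, t ∈ timeInterval a b)
    (hnc : ∀ᶠ t in l, ∀ i j, i ≠ j → ¬Collide x i j t) :
    ∃ z v, ∀ᶠ t in l, x t = z + (t - e) • v := by
  obtain ⟨c, d, hmem, -, hcd⟩ := hl.exists_Ioo (hab.and hnc)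
  have := hl.neBot
  obtain ⟨t₀, ht₀⟩ := nonempty_of_mem hmem
  obtain ⟨-, w, -, hw, -⟩ := h.law t₀ (hcd t₀ ht₀).1
  refine ⟨x t₀ + (e - t₀) • w, w, ?_⟩
  filter_upwards [hmem] with t ht
  obtain ⟨-, u, -, hu, -⟩ := h.law t (hcd t ht).1
  have key := constant_of_motion (x := x) isOpen_Ioo isPreconnected_Ioo
    (fun t ht => h.law t (hcd t ht).1) Prod.mk (fun t ht v w hv hw hvw => by
      have e : w = v := funext fun i => hvw.eq_of_forall fun j hji he =>
        hvw.velocity_eq hm hN (h.ordered t (hcd t ht).1) hv hw he ((hcd t ht).2 j i hji)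
      rw [e]) ht₀ ht hw hu
  simp only [Prod.mk.injEq] at key
  obtain ⟨h1, rfl⟩ := key
  rw [← sub_add_cancel (x t) (t • w), ← h1]
  module

theorem tendsto_of_eventually_uniform {x : ℝ → Fin N → ℝ} {l : Filter ℝ} {e : ℝ}
    (hl : IsSide l e) {z v : Fin N → ℝ} (hz : ∀ᶠ t in l, x t = z + (t - e) • v) :
    Tendsto x l (𝓝 z) := by
  have h1 : Tendsto (fun s : ℝ => z + (s - e) • v) (𝓝 e) (𝓝 (z + (e - e) • v)) :=
    (by fun_prop : Continuous fun s : ℝ => z + (s - e) • v).tendsto e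
  rw [sub_self, zero_smul, add_zero] at h1
  exact (h1.mono_left (hl.le.trans nhdsWithin_le_nhds)).congr' (hz.mono fun s hs => hs.symm)

theorem hasDirectMultipleCollision_of_triple {a b : EReal} {x : ℝ → Fin N → ℝ} {l : Filter ℝ}
    {e : ℝ} (hl : IsSide l e) (hab : ∀ᶠ t in l, t ∈ timeInterval a b)
    (hle : 𝓝[timeInterval a b \ {e}] e ≤ l) {z : Fin N → ℝ} (hz : Tendsto x l (𝓝 z))
    (hnc : ∀ᶠ t in l, ∀ i j, i ≠ j → ¬Collide x i j t)
    (htriple : ∃ i j k, i ≠ j ∧ j ≠ k ∧ i ≠ k ∧ z i = z j ∧ z j = z k) :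
    HasDirectMultipleCollision a b x e := by
  have := hl.neBot
  refine ⟨mem_closure_iff_frequently.2
    (hab.frequently.filter_mono (hl.le.trans nhdsWithin_le_nhds)), ?_⟩
  -- Among three distinct indices, some two differ by at least `2`.
  obtain ⟨lo, hi, h1, h2⟩ : ∃ lo hi : Fin N, lo.val + 2 ≤ hi.val ∧ z lo = z hi := by
    obtain ⟨i, j, k, hij, hjk, hik, e1, e2⟩ := htriple
    have hij' : i.val ≠ j.val := fun h => hij (Fin.ext h)
    have hjk' : j.val ≠ k.val := fun h => hjk (Fin.ext h)
    have hik' : i.val ≠ k.val := fun h => hik (Fin.ext h)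
    by_cases c1 : i.val + 2 ≤ j.val
    · exact ⟨i, j, c1, e1⟩
    by_cases c2 : j.val + 2 ≤ i.val
    · exact ⟨j, i, c2, e1.symm⟩
    by_cases c3 : j.val + 2 ≤ k.val
    · exact ⟨j, k, c3, e2⟩
    by_cases c4 : k.val + 2 ≤ j.val
    · exact ⟨k, j, c4, e2.symm⟩
    by_cases c5 : i.val + 2 ≤ k.val
    · exact ⟨i, k, c5, e1.trans e2⟩
    · exact ⟨k, i, by omega, (e1.trans e2).symm⟩
  refine ⟨lo, hi, h1, ?_, ?_⟩
  · rw [tendsto_pi_nhds] at hz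
    simpa [h2] using ((hz hi).sub (hz lo)).mono_left hle
  · filter_upwards [hle hnc] with t ht j l _ hjl _ using ht j l hjl.ne

/-! ### Extension of solutions -/

theorem CollisionLaw.exists_of_no_triple (m : Fin N → ℝ) {q : Fin N → ℝ}
    (hq : ∀ i j k, i ≠ j → j ≠ k → i ≠ k → ¬(q i = q j ∧ q j = q k)) (v : Fin N → ℝ) :
    ∃ w, CollisionLaw m q v w := by
  classical
  refine ⟨fun i => if h : ∃ j, i ≠ j ∧ q i = q j then
    (1 - collisionCoeff m i h.choose) * v i + collisionCoeff m i h.choose * v h.choose else v i,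
    hq, fun i j hij he => ?_, fun i hi => ?_⟩
  · have h : ∃ j, i ≠ j ∧ q i = q j := ⟨j, hij, he⟩
    have hj : h.choose = j := by
      by_contra hne
      exact hq _ _ _ h.choose_spec.1.symm hij hne ⟨h.choose_spec.2.symm, he⟩
    simp only [dif_pos h, hj]
  · exact dif_neg fun ⟨j, hij, he⟩ => hi j hij.symm he.symm

namespace IsSolution

variable {m : Fin N → ℝ} {a b : EReal} {x : ℝ → Fin N → ℝ}

theorem neg_mem_timeInterval_iff {t : ℝ} : t ∈ timeInterval (-b) (-a) ↔ -t ∈ timeInterval a b := by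
  simp only [timeInterval, Set.mem_ofPred_eq, EReal.coe_neg]
  rw [EReal.neg_lt_comm, EReal.lt_neg_comm, and_comm]

theorem reverse (h : IsSolution m a b x) : IsSolution m (-b) (-a) fun t => x (-t) := by
  refine ⟨by simpa [EReal.neg_lt_comm] using h.end_pos, by simpa [EReal.lt_neg_comm] using h.start_neg,
    fun t ht => h.ordered _ (neg_mem_timeInterval_iff.1 ht), fun t ht => ?_⟩
  obtain ⟨v, w, hv, hw, hvw⟩ := h.law _ (neg_mem_timeInterval_iff.1 ht)
  refine ⟨-w, -v, ?_, ?_, hvw.reverse⟩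
  · have : Tendsto (fun s : ℝ => -s) (𝓝[<] t) (𝓝[>] (-t)) := tendsto_neg_nhdsLT
    filter_upwards [this.eventually hw] with s hs
    rw [hs]
    module
  · have : Tendsto (fun s : ℝ => -s) (𝓝[>] t) (𝓝[<] (-t)) := tendsto_neg_nhdsGT
    filter_upwards [this.eventually hv] with s hs
    rw [hs]
    module

/-- A solution that is uniform before the right end of its time interval and approaches a
configuration without contacts of three particles can be extended to the right. -/
theorem exists_extension_right {e : ℝ} (h : IsSolution m a e x) (hm : MassCondition m)
    (hN : 3 ≤ N) {z v : Fin N → ℝ} (hz : ∀ᶠ t in 𝓝[<] e, x t = z + (t - e) • v)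
    (hab : ∀ᶠ t in 𝓝[<] e, t ∈ timeInterval a e)
    (hno : ∀ i j k, i ≠ j → j ≠ k → i ≠ k → ¬(z i = z j ∧ z j = z k)) :
    ∃ (b' : EReal) (x' : ℝ → Fin N → ℝ), (e : EReal) < b' ∧ IsSolution m a b' x' ∧
      Set.EqOn x' x (timeInterval a e) := by
  obtain ⟨w, hvw⟩ := CollisionLaw.exists_of_no_triple m hno v
  have hzm : Monotone z := by
    have hlim := tendsto_pi_nhds.1 (tendsto_of_eventually_uniform (Or.inl rfl) hz)
    intro i j hij
    refine le_of_tendsto_of_tendsto (hlim i) (hlim j) ?_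
    filter_upwards [hab] with t ht using h.ordered t ht hij
  -- The order before `e` forces particles that meet at `e` not to be separating; the collision
  -- reverses their relative velocity, so the order persists after it.
  have hwm : ∀ i j, i < j → z i = z j → w i ≤ w j := by
    intro i j hij he
    have h1 := hvw.sub_eq_neg hij.ne he (hvw.mass_add_ne_zero hm hN hzm hij.ne he)
    obtain ⟨t, ⟨h2, h3⟩, h4⟩ := ((hz.and hab).and self_mem_nhdsWithin).exists
    have h5 := h.ordered t h3 hij.le
    have h6 : t - e < 0 := sub_neg.2 h4
    simp only [h2, Pi.add_apply, Pi.smul_apply, smul_eq_mul, he] at h5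
    nlinarith
  have hcont : ∀ i, Tendsto (fun t : ℝ => (z + (t - e) • w) i) (𝓝[>] e) (𝓝 (z i)) := fun i => by
    have h1 : Continuous fun t : ℝ => (z + (t - e) • w) i := by
      simp only [Pi.add_apply, Pi.smul_apply, smul_eq_mul]
      fun_prop
    have h2 := (h1.tendsto e).mono_left (nhdsWithin_le_nhds (s := Set.Ioi e))
    simpa using h2
  have hev : ∀ᶠ t in 𝓝[>] e, Monotone (z + (t - e) • w) ∧
      ∀ i j, z i ≠ z j → (z + (t - e) • w) i ≠ (z + (t - e) • w) j := by
    refine Eventually.and ?_ ?_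
    · have : ∀ᶠ t in 𝓝[>] e, ∀ i j, i < j → (z + (t - e) • w) i ≤ (z + (t - e) • w) j := by
        refine eventually_all.2 fun i => eventually_all.2 fun j => eventually_imp_distrib_left.2
          fun hij => ?_
        rcases (hzm hij.le).lt_or_eq with hlt | heq
        · exact ((hcont i).eventually_lt (hcont j) hlt).mono fun t ht => ht.le
        · filter_upwards [self_mem_nhdsWithin] with t ht
          have := mul_le_mul_of_nonneg_left (hwm i j hij heq) (sub_pos.2 ht).le
          simp only [Pi.add_apply, Pi.smul_apply, smul_eq_mul]
          linarith
      filter_upwards [this] with t ht i j hij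
      rcases hij.lt_or_eq with hlt | rfl
      · exact ht i j hlt
      · exact le_rfl
    · refine eventually_all.2 fun i => eventually_all.2 fun j => eventually_imp_distrib_left.2
        fun hij => ?_
      filter_upwards [((hcont i).sub (hcont j)).eventually_ne (sub_ne_zero.2 hij)] with t ht
      exact sub_ne_zero.1 ht
  obtain ⟨d, hed, hd⟩ := mem_nhdsGT_iff_exists_Ioo_subset.1 hev
  have hed' : e < d := hed
  set x' : ℝ → Fin N → ℝ := fun t => if t < e then x t else z + (t - e) • w with hx'
  have hlt : ∀ {t}, t < e → x' t = x t := fun ht => if_pos ht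
  have hge : ∀ {t}, e ≤ t → x' t = z + (t - e) • w := fun ht => if_neg ht.not_gt
  have hlt' : ∀ {t}, t < e → x' =ᶠ[𝓝 t] x := fun ht => by
    filter_upwards [Iio_mem_nhds ht] with s hs using hlt hs
  have hee : x' e = z := by simp [hge le_rfl]
  refine ⟨d, x', EReal.coe_lt_coe_iff.2 hed, ⟨h.start_neg,
    h.end_pos.trans (EReal.coe_lt_coe_iff.2 hed), fun t ht => ?_, fun t ht => ?_⟩, fun t ht => ?_⟩
  · rcases lt_trichotomy t e with hte | rfl | hte
    · rw [hlt hte]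
      exact h.ordered t ⟨ht.1, EReal.coe_lt_coe_iff.2 hte⟩
    · rwa [hee]
    · rw [hge hte.le]
      exact (hd ⟨hte, EReal.coe_lt_coe_iff.1 ht.2⟩).1
  · rcases lt_trichotomy t e with hte | rfl | hte
    · obtain ⟨v', w', hv', hw', hvw'⟩ := h.law t ⟨ht.1, EReal.coe_lt_coe_iff.2 hte⟩
      rw [← hlt hte] at hvw'
      refine ⟨v', w', ?_, ?_, hvw'⟩
      · filter_upwards [hv', (hlt' hte).filter_mono nhdsWithin_le_nhds] with s hs hs'
        rw [hs', hs, hlt hte]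
      · filter_upwards [hw', (hlt' hte).filter_mono nhdsWithin_le_nhds] with s hs hs'
        rw [hs', hs, hlt hte]
    · refine ⟨v, w, ?_, ?_, by rwa [hee]⟩
      · filter_upwards [hz, self_mem_nhdsWithin] with s hs hst
        rw [hlt hst, hs, hee]
      · filter_upwards [self_mem_nhdsWithin] with s hst
        rw [hge (le_of_lt hst), hee]
    -- Shortly after `e` only particles already in contact at `e` can touch, and then they move with
    -- equal velocities, so the law holds with `w` on both sides.
    · have hne := (hd ⟨hte, EReal.coe_lt_coe_iff.1 ht.2⟩).2
      obtain ⟨-, h1, h2⟩ := velocity_of_eventually_eq (x := x') (t := t) (w := w)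
        (y := z - e • w) <| by
          filter_upwards [Ioi_mem_nhds hte] with s hs
          rw [hge (le_of_lt hs)]
          module
      refine ⟨w, w, h1, h2, ?_⟩
      rw [hge hte.le]
      have hc : ∀ i j, (z + (t - e) • w) i = (z + (t - e) • w) j → z i = z j := fun i j hij => by
        by_contra hn
        exact hne i j hn hij
      refine ⟨fun i j k h1 h2 h3 h4 => hno i j k h1 h2 h3 ⟨hc _ _ h4.1, hc _ _ h4.2⟩,
        fun i j hij hq => ?_, fun _ _ => rfl⟩
      have hzij := hc i j hq
      simp only [Pi.add_apply, Pi.smul_apply, smul_eq_mul, hzij, add_right_inj] at hq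
      rw [mul_left_cancel₀ (sub_pos.2 hte).ne' hq]
      ring
  · exact hlt (EReal.coe_lt_coe_iff.1 ht.2)

end IsSolution

/-! ### Maximal solutions -/

namespace IsMaximalSolution

variable {m : Fin N → ℝ} {a b : EReal} {x : ℝ → Fin N → ℝ}

/-- Without accumulation the motion is uniform near the end. A triple contact in the limit
contradicts `hd`, and its absence contradicts maximality. -/
theorem hasCollapse_right {e : ℝ} (h : IsMaximalSolution m a e x) (hm : MassCondition m)
    (hN : 3 ≤ N) (hd : ¬HasDirectMultipleCollision a e x e) : HasCollapse a e x e := by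
  have hsol := h.isSolution
  have he : 0 < e := EReal.coe_lt_coe_iff.1 hsol.zero_mem.2
  have hl : IsSide (𝓝[<] e) e := Or.inl rfl
  have hab : ∀ᶠ t in 𝓝[<] e, t ∈ timeInterval a e := by
    filter_upwards [Ioo_mem_nhdsLT he] with t ht
    exact ⟨hsol.zero_mem.1.trans (EReal.coe_lt_coe_iff.2 ht.1), EReal.coe_lt_coe_iff.2 ht.2⟩
  refine hasCollapse_of_frequently hl fun hcon => hd ?_
  have hnc : ∀ᶠ t in 𝓝[<] e, ∀ i j, i ≠ j → ¬Collide x i j t := by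
    filter_upwards [hab, hcon] with t ht h i j hij hc using h ⟨ht, i, j, hij, hc⟩
  obtain ⟨z, v, hz⟩ := hsol.eventually_uniform hm hN hl hab hnc
  refine hasDirectMultipleCollision_of_triple hl hab
    (nhdsWithin_mono _ fun t ht => EReal.coe_lt_coe_iff.1 ht.1.2)
    (tendsto_of_eventually_uniform hl hz) hnc ?_
  by_contra hno
  push Not at hno
  obtain ⟨b', x', hb', hx', heq⟩ := hsol.exists_extension_right hm hN hz hab
    fun i j k h1 h2 h3 h4 => hno i j k h1 h2 h3 h4.1 h4.2
  exact hb'.ne' (h.maximal a b' x' le_rfl hb'.le hx' heq).2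

theorem hasCollapse_left {e : ℝ} (h : IsMaximalSolution m e b x) (hm : MassCondition m)
    (hN : 3 ≤ N) (hd : ¬HasDirectMultipleCollision e b x e) : HasCollapse e b x e := by
  have hsol := h.isSolution
  have he : e < 0 := EReal.coe_lt_coe_iff.1 hsol.zero_mem.1
  have hl : IsSide (𝓝[>] e) e := Or.inr rfl
  have hab : ∀ᶠ t in 𝓝[>] e, t ∈ timeInterval e b := by
    filter_upwards [Ioo_mem_nhdsGT he] with t ht
    exact ⟨EReal.coe_lt_coe_iff.2 ht.1, (EReal.coe_lt_coe_iff.2 ht.2).trans hsol.zero_mem.2⟩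
  refine hasCollapse_of_frequently hl fun hcon => hd ?_
  have hnc : ∀ᶠ t in 𝓝[>] e, ∀ i j, i ≠ j → ¬Collide x i j t := by
    filter_upwards [hab, hcon] with t ht h i j hij hc using h ⟨ht, i, j, hij, hc⟩
  obtain ⟨z, v, hz⟩ := hsol.eventually_uniform hm hN hl hab hnc
  refine hasDirectMultipleCollision_of_triple hl hab
    (nhdsWithin_mono _ fun t ht => EReal.coe_lt_coe_iff.1 ht.1.1)
    (tendsto_of_eventually_uniform hl hz) hnc ?_
  by_contra hno
  push Not at hno
  have hneg : Tendsto (fun t : ℝ => -t) (𝓝[<] (-e)) (𝓝[>] e) := by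
    simpa using tendsto_neg_nhdsLT (a := -e)
  -- Time reversal turns an extension to the left into one to the right.
  have hrev : IsSolution m (-b) ((-e : ℝ) : EReal) fun t => x (-t) := by
    rw [EReal.coe_neg]
    exact hsol.reverse
  obtain ⟨b', x', hb', hx', heq⟩ := hrev.exists_extension_right hm hN (z := z) (v := -v)
    (by
      filter_upwards [hneg.eventually hz] with t ht
      rw [ht]
      module)
    (by
      filter_upwards [hneg.eventually hab] with t ht
      rw [EReal.coe_neg]
      exact IsSolution.neg_mem_timeInterval_iff.2 ht)
    fun i j k h1 h2 h3 h4 => hno i j k h1 h2 h3 h4.1 h4.2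
  have hx'' := hx'.reverse
  rw [neg_neg] at hx''
  have hlt : -b' < e := by
    rw [EReal.neg_lt_comm]
    exact_mod_cast hb'
  refine hlt.ne (h.maximal (-b') b _ hlt.le le_rfl hx'' fun t ht => ?_).1
  have := heq (x := -t) (by
    rw [EReal.coe_neg]
    exact IsSolution.neg_mem_timeInterval_iff.2 (by rwa [neg_neg]))
  simpa using this

end IsMaximalSolution

/-! ### Maximal solutions end in finite time -/

/-- The extrapolation of the initial motion stays timelike. -/
theorem IsSolution.relForm_extrapolation_pos {m : Fin N → ℝ} {a b : EReal} {x : ℝ → Fin N → ℝ}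
    (h : IsSolution m a b x) (hm : MassCondition m) (hN : 3 ≤ N) {v : Fin N → ℝ}
    (hv : VelocityAfter x 0 v) {t : ℝ} (ht : t ∈ timeInterval a b) :
    0 < relForm m Finset.univ (x 0 + t • v) (x 0 + t • v) := by
  obtain ⟨_, w, -, hw, hlaw⟩ := h.law t ht
  have key := (h.relForm_eq_extrapolation hm hN (isOpen_timeInterval a b)
    (ordConnected_timeInterval a b).isPreconnected subset_rfl (S := Finset.univ)
    (fun _ _ _ _ j hj => absurd (Finset.mem_univ j) hj) h.zero_mem ht hv hw).2 t
  simp only [sub_zero, sub_self, zero_smul, add_zero] at key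
  rw [key]
  have hmono := h.ordered t ht
  let f : Fin N := ⟨0, by omega⟩
  let k : Fin N := ⟨1, by omega⟩
  let z : Fin N := ⟨N - 1, by omega⟩
  have hfk : f < k := Fin.lt_def.2 Nat.zero_lt_one
  have hkz : k < z := Fin.lt_def.2 (by simp only [k, z]; omega)
  -- If the ends met, the particle between them would make a triple contact; this uses `N ≥ 3`.
  refine hm.relForm_pos (f := f) (z := z) rfl (by simp only [z]; omega) hmono
    ((hmono (hfk.trans hkz).le).lt_of_ne fun he => ?_)
  have h1 := hmono hfk.le
  have h2 := hmono hkz.le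
  exact hlaw.no_triple f k z hfk.ne hkz.ne (hfk.trans hkz).ne ⟨by linarith, by linarith⟩

theorem exists_quadratic_nonpos {α : ℝ} (hα : α < 0) (β γ : ℝ) :
    ∃ T > 0, γ + 2 * T * β + T ^ 2 * α ≤ 0 ∧ γ + 2 * (-T) * β + (-T) ^ 2 * α ≤ 0 := by
  set D := (|γ| + 2 * |β|) / (-α) with hD
  have hD0 : 0 ≤ D := div_nonneg (by positivity) (neg_nonneg.2 hα.le)
  have hDα : D * (-α) = |γ| + 2 * |β| := div_mul_cancel₀ _ (neg_pos.2 hα).ne'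
  have h1 : (1 + D) ^ 2 * α ≤ -(1 + D) * (|γ| + 2 * |β|) := by nlinarith
  have h2 : |γ| ≤ (1 + D) * |γ| := le_mul_of_one_le_left (abs_nonneg _) (by linarith)
  have h3 := mul_le_mul_of_nonneg_left (le_abs_self β) (by linarith : 0 ≤ 1 + D)
  have h4 := mul_le_mul_of_nonneg_left (neg_abs_le β) (by linarith : 0 ≤ 1 + D)
  have h5 := le_abs_self γ
  refine ⟨1 + D, by linarith, by linarith, ?_⟩
  rw [neg_sq]
  linarith

theorem EReal_eq_top_or_coe {b : EReal} (hb : 0 < b) : b = ⊤ ∨ ∃ e : ℝ, b = e := by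
  induction b using EReal.rec with
  | bot => exact absurd hb (by simp)
  | coe e => exact Or.inr ⟨e, rfl⟩
  | top => exact Or.inl rfl

theorem EReal_eq_bot_or_coe {a : EReal} (ha : a < 0) : a = ⊥ ∨ ∃ e : ℝ, a = e := by
  induction a using EReal.rec with
  | bot => exact Or.inl rfl
  | coe e => exact Or.inr ⟨e, rfl⟩
  | top => exact absurd ha (by simp)

namespace IsMaximalSolution

variable {m : Fin N → ℝ} {a b : EReal} {x : ℝ → Fin N → ℝ}

theorem hasGlobalCollapse_right (h : IsMaximalSolution m a b x) (hm : MassCondition m)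
    (hN : 3 ≤ N) (hd : ∀ s, ¬HasDirectMultipleCollision a b x s) (hb : b ≠ ⊤) :
    ∃ s : ℝ, 0 < s ∧ HasGlobalCollapse a b x s := by
  obtain rfl | ⟨e, rfl⟩ := EReal_eq_top_or_coe h.isSolution.end_pos
  · exact absurd rfl hb
  · exact ⟨e, EReal.coe_lt_coe_iff.1 h.isSolution.end_pos,
      h.isSolution.hasGlobalCollapse hm hN (h.hasCollapse_right hm hN (hd e))⟩

theorem hasGlobalCollapse_left (h : IsMaximalSolution m a b x) (hm : MassCondition m)
    (hN : 3 ≤ N) (hd : ∀ s, ¬HasDirectMultipleCollision a b x s) (ha : a ≠ ⊥) :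
    ∃ s : ℝ, s < 0 ∧ HasGlobalCollapse a b x s := by
  obtain rfl | ⟨e, rfl⟩ := EReal_eq_bot_or_coe h.isSolution.start_neg
  · exact absurd rfl ha
  · exact ⟨e, EReal.coe_lt_coe_iff.1 h.isSolution.start_neg,
      h.isSolution.hasGlobalCollapse hm hN (h.hasCollapse_left hm hN (hd e))⟩

theorem hasDoubleGlobalCollapse (h : IsMaximalSolution m a b x) (hm : MassCondition m)
    (hN : 3 ≤ N) (hd : ∀ s, ¬HasDirectMultipleCollision a b x s) {v : Fin N → ℝ}
    (hv : VelocityAfter x 0 v) (hE : energy m v < 0) : HasDoubleGlobalCollapse a b x := by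
  have hsol := h.isSolution
  rw [energy_eq_relForm hm.totalMass_ne_zero] at hE
  obtain ⟨T, hT, h1, h2⟩ := exists_quadratic_nonpos (by linarith : relForm m Finset.univ v v < 0)
    (relForm m Finset.univ (x 0) v) (relForm m Finset.univ (x 0) (x 0))
  rw [← relForm_add_smul] at h1 h2
  have hb : b ≠ ⊤ := by
    rintro rfl
    refine h1.not_gt (hsol.relForm_extrapolation_pos hm hN hv ⟨?_, EReal.coe_lt_top T⟩)
    exact hsol.start_neg.trans (EReal.coe_lt_coe_iff.2 hT)
  have ha : a ≠ ⊥ := by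
    rintro rfl
    refine h2.not_gt (hsol.relForm_extrapolation_pos hm hN hv ⟨EReal.bot_lt_coe _, ?_⟩)
    exact (EReal.coe_lt_coe_iff.2 (neg_neg_of_pos hT)).trans hsol.end_pos
  obtain ⟨s₁, hs₁, hc₁⟩ := h.hasGlobalCollapse_right hm hN hd hb
  obtain ⟨s₂, hs₂, hc₂⟩ := h.hasGlobalCollapse_left hm hN hd ha
  exact ⟨s₁, s₂, hs₁, hs₂, hc₁, hc₂⟩

theorem exists_hasGlobalCollapse (h : IsMaximalSolution m a b x) (hm : MassCondition m)
    (hN : 3 ≤ N) (hd : ∀ s, ¬HasDirectMultipleCollision a b x s) {v : Fin N → ℝ}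
    (hv : VelocityAfter x 0 v) (hne : ¬∀ i j, v i = v j) (hE : 0 ≤ energy m v) :
    ∃ s : ℝ, HasGlobalCollapse a b x s := by
  by_cases hb : b = ⊤
  · by_cases ha : a = ⊥
    · exfalso
      subst hb ha
      rw [energy_eq_relForm hm.totalMass_ne_zero] at hE
      obtain ⟨φ, hφ⟩ := hm.exists_hyperplane (by omega)
      -- If `φ v = 0`, nonnegative energy forces equal velocities. Otherwise the extrapolated line
      -- meets the hyperplane at the time `-φ (x 0) / φ v`, where it should still be timelike.
      by_cases hφv : φ v = 0
      · obtain ⟨h1, h2⟩ := hφ v hφv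
        exact hne (h2 (by linarith))
      · refine (hφ (x 0 + (-(φ (x 0)) / φ v) • v) ?_).1.not_gt
          (h.isSolution.relForm_extrapolation_pos hm hN hv
            ⟨EReal.bot_lt_coe _, EReal.coe_lt_top _⟩)
        rw [map_add, map_smul, smul_eq_mul, div_mul_cancel₀ _ hφv, add_neg_cancel]
    · obtain ⟨s, -, hs⟩ := h.hasGlobalCollapse_left hm hN hd ha
      exact ⟨s, hs⟩
  · obtain ⟨s, -, hs⟩ := h.hasGlobalCollapse_right hm hN hd hb
    exact ⟨s, hs⟩

end IsMaximalSolution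

end LineParticles

open LineParticles in
theorem mainTheorem2 (N : ℕ) (hN : 3 ≤ N) (m : Fin N → ℝ) (hm : MassCondition m) :
    (∀ (a b : EReal) (x : ℝ → Fin N → ℝ), IsSolution m a b x →
      ∀ s : ℝ, HasCollapse a b x s → HasGlobalCollapse a b x s) ∧
    HasSignature ((massForm m).restrict (zeroMomentum m)) 1 (N - 2) ∧
    (∀ (a b : EReal) (x : ℝ → Fin N → ℝ), IsMaximalSolution m a b x →
      ∀ v : Fin N → ℝ, VelocityAfter x 0 v → (¬∀ i j, v i = v j) →
      (∀ s : ℝ, ¬HasDirectMultipleCollision a b x s) →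
      (energy m v < 0 → HasDoubleGlobalCollapse a b x) ∧
      (0 ≤ energy m v → ∃ s : ℝ, HasGlobalCollapse a b x s)) :=
  ⟨fun _ _ _ h _ hs => h.hasGlobalCollapse hm hN hs, hm.hasSignature hN,
    fun _ _ _ h _ hv hne hd =>
      ⟨fun hE => h.hasDoubleGlobalCollapse hm hN hd hv hE,
        fun hE => h.exists_hasGlobalCollapse hm hN hd hv hne hE⟩⟩
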